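/- Let $\overline{\mathbb R}^3_+=\{y\in\mathbb R^3 : y_3\ge 0\}$ and let $\theta\in(0,\frac{\pi}{2}]$. Let $\Sigma\subset\overline{\mathbb R}^3_+$ be a smooth, compact, properly embedded surface with non-empty boundary: $\Sigma$ is the image of a smooth embedding $x:M\to\mathbb R^3$ of a compact smooth surface $M$ with boundary $\partial M\neq\emptyset$ such that $x(\mathrm{int}\,M)\subset\{y_3>0\}$ and $\partial\Sigma:=x(\partial M)\subset\{y_3=0\}$. Let $\nu$ be its (outward) smooth unit normal field, and suppose that * $\Sigma$ is capillary with constant contact angle $\theta$: $\langle\nu,-e_3\rangle=\cos(\pi-\theta)$ along $\partial\Sigma$; * $\Sigma$ is convex: its second fundamental form $h(X,Y)=\langle D_X\nu,Y\rangle$ is positive semidefinite everywhere. Let $H=\operatorname{tr}_g h$ (the sum of the principal curvatures, with $g$ the induced metric), let $dA$ be the area element of $\Sigma$, and let $|\mathbb S^2_\theta|$ be the area of $\mathbb S^2_\theta=\{y\in\mathbb R^3 : |y|=1,\ \langle y,e_3\rangle>\cos\theta\}$. Then $H^2$ is integrable on $\Sigma$ and $$\int_\Sigma H^2\,dA\ \ge\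 4\,|\mathbb S^2_\theta| .$$ Equality holds if and only if $\Sigma$ is a spherical cap with contact angle $\theta$, that is, if and only if there are $r>0$ and a horizontal vector $a\in\mathbb R^2\times\{0\}$ with $$\Sigma=a+\bigl\{y\in\overline{\mathbb R}^3_+ : |y+r\cos\theta\, e_3|=r\bigr\}.$$ -/

import Mathlib

open MeasureTheory
open scoped Manifold ContDiff

noncomputable section

namespace CapillarySurface

/-- Euclidean three-space. -/
abbrev E3 : Type := EuclideanSpace ℝ (Fin 3)

/-- The vertical basis vector `e₃`; the half-space is `{y | 0 ≤ y 2}` and the constant outward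
unit normal of its boundary plane is `-e₃`. -/
def e3 : E3 := EuclideanSpace.single 2 1

section Curvature

variable {M : Type*} [TopologicalSpace M] [ChartedSpace (EuclideanHalfSpace 2) M]

/-- The differential of a map `f : M → ℝ³` from a surface with boundary, at the point `p`. -/
def differential (f : M → E3) (p : M) : TangentSpace (𝓡∂ 2) p →L[ℝ] E3 :=
  mfderiv (𝓡∂ 2) 𝓘(ℝ, E3) f p

/-- The metric `g` induced by `x`: `g(v, w) = ⟨dx v, dx w⟩`. -/
def firstForm (x : M → E3) (p : M) (v w : TangentSpace (𝓡∂ 2) p) : ℝ :=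
  inner ℝ (differential x p v) (differential x p w)

/-- The second fundamental form `h` of `x` with respect to the unit normal field `ν`, with the
sign convention `D_X Y = ∇_X Y - h(X, Y) ν`, that is, `h(v, w) = ⟨D_v ν, dx w⟩`
(positive for a round sphere and its outward normal). -/
def secondForm (x ν : M → E3) (p : M) (v w : TangentSpace (𝓡∂ 2) p) : ℝ :=
  inner ℝ (differential ν p v) (differential x p w)

/-- The standard basis of the tangent space at `p`, which in Mathlib is the model space `ℝ²`,
identified with it through the preferred chart at `p`. -/
def tangentBasis (p : M) (i : Fin 2) : TangentSpace (𝓡∂ 2) p :=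
  (EuclideanSpace.single i 1 : EuclideanSpace ℝ (Fin 2))

/-- The matrix `(g_ij)` of the induced metric. -/
def firstFormMatrix (x : M → E3) (p : M) : Matrix (Fin 2) (Fin 2) ℝ :=
  Matrix.of fun i j => firstForm x p (tangentBasis p i) (tangentBasis p j)

/-- The matrix `(h_ij)` of the second fundamental form. -/
def secondFormMatrix (x ν : M → E3) (p : M) : Matrix (Fin 2) (Fin 2) ℝ :=
  Matrix.of fun i j => secondForm x ν p (tangentBasis p i) (tangentBasis p j)

/-- The (unnormalized) mean curvature `H = g^{ij} h_{ij} = κ₁ + κ₂`, the trace of the Weingarten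
map `(h^i_j) = (g^{ik} h_{kj})`. -/
def meanCurvature (x ν : M → E3) (p : M) : ℝ :=
  Matrix.trace ((firstFormMatrix x p)⁻¹ * secondFormMatrix x ν p)

/-- The area measure `dA` of an embedded surface `x : M → ℝ³`: the two-dimensional Hausdorff
measure of `ℝ³` (normalized so as to agree with Lebesgue measure on planes), pulled back to `M`. -/
def areaMeasure [MeasurableSpace M] (x : M → E3) : Measure M :=
  Measure.comap x μHE[2]

/-- `x : M → ℝ³` parametrizes a smooth, properly embedded capillary surface with boundary in the
closed upper half-space, with unit normal field `ν` and constant contact angle `θ`. -/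
structure IsCapillarySurface (θ : ℝ) (x ν : M → E3) : Prop where
  smooth : ContMDiff (𝓡∂ 2) 𝓘(ℝ, E3) ∞ x
  immersion : ∀ p : M, Function.Injective (differential x p)
  embedding : Topology.IsEmbedding x
  boundary_nonempty : ((𝓡∂ 2).boundary M).Nonempty
  interior_pos : ∀ p ∈ (𝓡∂ 2).interior M, 0 < x p 2
  boundary_zero : ∀ p ∈ (𝓡∂ 2).boundary M, x p 2 = 0
  smooth_normal : ContMDiff (𝓡∂ 2) 𝓘(ℝ, E3) ∞ ν
  norm_normal : ∀ p : M, ‖ν p‖ = 1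
  normal_orthogonal : ∀ (p : M) (v : TangentSpace (𝓡∂ 2) p),
    inner ℝ (ν p) (differential x p v) = 0
  contact_angle : ∀ p ∈ (𝓡∂ 2).boundary M, inner ℝ (ν p) (-e3) = Real.cos (Real.pi - θ)

/-- A capillary surface is convex if its second fundamental form with respect to `ν` is positive
semidefinite. (On each connected component of a compact embedded surface this forces `ν` to be the
outward normal of the domain that the component encloses, together with the plane `y 2 = 0`.) -/
structure IsConvexCapillarySurface (θ : ℝ) (x ν : M → E3) : Prop
    extends IsCapillarySurface θ x ν where
  convex : ∀ (p : M) (v : TangentSpace (𝓡∂ 2) p), 0 ≤ secondForm x ν p v v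

end Curvature

/-- The model cap `S²_θ = {y ∈ S² | ⟨y, e₃⟩ > cos θ}` of the unit sphere. -/
def modelCap (θ : ℝ) : Set E3 := {y | ‖y‖ = 1 ∧ Real.cos θ < inner ℝ y e3}

/-- The spherical cap `C_{r,θ}(e) = {y | 0 ≤ y₃, |y - r cos θ e| = r}` of radius `r` with `e = -e₃`,
which meets the plane `y₃ = 0` at the angle `θ`. -/
def sphericalCap (r θ : ℝ) : Set E3 :=
  {y | 0 ≤ y 2 ∧ ‖y - (r * Real.cos θ) • (-e3)‖ = r}

end CapillarySurface

end

noncomputable section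

namespace CapillarySurface

open Set Filter Topology
open scoped NNReal ENNReal

/-! Write K for the Gauss curvature and S for the model cap. The inequality is the chain 4|S| ≤ 4∫K
≤ ∫H², whose second step is (κ₁ - κ₂)² ≥ 0.

For the first step, fix a unit vector n with n₃ > cos θ and maximize the height ⟨x, n⟩. The contact
angle makes this height increase strictly from each boundary point into the surface
(`IsCapillarySurface.not_isMax_boundary`), so the maximum is interior and ν = ±n there. If ν = -n,
maximality and convexity together force h = 0, hence K = 0. Since the area of a Gauss image is at
most the integral of K (`IsConvexCapillarySurface.measure_normal_image_le`), such exceptional n form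
a null set. Thus ν covers almost all of S and |S| ≤ ∫K. The argument works on each nonempty clopen
part of M separately (`IsConvexCapillarySurface.measure_modelCap_le`), so connectedness is not
needed.

The area comparison is local (`exists_nhds_measure_image_le`): the surface and its Gauss image are
both projected to the tangent plane at a point, where K is a Jacobian determinant. The projection is
1-Lipschitz, and on the sphere near ν it is almost isometric.

In case of equality the interior is totally umbilical, so with k = H/2 the pair (k, ν - kx) is
locally constant. Two disjoint clopen parts would cost 2|S|, so the pair is constant. The boundary
angle excludes k = 0, hence x = c + ν/k lies on a sphere, and the covering of S by normals shows
that the whole cap is attained. For the converse, H² = 4/r² and the area r²|S| are computed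
directly. -/

/-- The Euclidean plane. -/
abbrev E2 : Type := EuclideanSpace ℝ (Fin 2)

/-! ### Hausdorff measure -/

lemma euclideanHausdorffMeasure_image_le_of_lipschitzOn {X Y : Type*} [EMetricSpace X]
    [EMetricSpace Y] [MeasurableSpace X] [BorelSpace X] [MeasurableSpace Y] [BorelSpace Y]
    {K : ℝ≥0} {f : X → Y} {s : Set X} (h : LipschitzOnWith K f s) :
    (μHE[2] : Measure Y) (f '' s) ≤ (K : ℝ≥0∞) ^ 2 * (μHE[2] : Measure X) s := by
  have h2 := h.hausdorffMeasure_image_le (d := ((2 : ℕ) : ℝ)) (by positivity)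
  rw [ENNReal.rpow_natCast] at h2
  simp only [Measure.euclideanHausdorffMeasure_def, Measure.smul_apply, ENNReal.smul_def,
    smul_eq_mul]
  rw [mul_left_comm]
  gcongr

lemma euclideanHausdorffMeasure_le_of_dist_le {X Y : Type*} [MetricSpace X]
    [MetricSpace Y] [MeasurableSpace X] [BorelSpace X] [MeasurableSpace Y] [BorelSpace Y]
    {K : ℝ≥0} {f : X → Y} {s : Set X} (h : ∀ u ∈ s, ∀ w ∈ s, dist u w ≤ K * dist (f u) (f w)) :
    (μHE[2] : Measure X) s ≤ (K : ℝ≥0∞) ^ 2 * (μHE[2] : Measure Y) (f '' s) := by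
  rcases s.eq_empty_or_nonempty with rfl | ⟨x₀, hx₀⟩
  · simp
  have : Nonempty X := ⟨x₀⟩
  have hinj : InjOn f s := fun u hu w hw e => by
    have := h u hu w hw
    rw [e, dist_self, mul_zero] at this
    exact dist_le_zero.1 this
  have hl : LipschitzOnWith K (Function.invFunOn f s) (f '' s) := by
    apply LipschitzOnWith.of_dist_le_mul
    rintro _ ⟨u, hu, rfl⟩ _ ⟨w, hw, rfl⟩
    rw [hinj.leftInvOn_invFunOn hu, hinj.leftInvOn_invFunOn hw]
    exact h u hu w hw
  have := euclideanHausdorffMeasure_image_le_of_lipschitzOn hl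
  rwa [hinj.leftInvOn_invFunOn.image_image] at this

/-! ### Orthogonal projection along a unit vector -/

/-- The projection onto the plane n^⊥, identified isometrically with ℝ². The polarized Pythagorean
identity is the only property of `P` used later. -/
lemma exists_orthogonal_projection {n : E3} (hn : ‖n‖ = 1) :
    ∃ P : E3 →L[ℝ] E2, ∀ y z, inner ℝ (P y) (P z) + inner ℝ n y * inner ℝ n z = inner ℝ y z := by
  have : Fact (Module.finrank ℝ E3 = 2 + 1) := ⟨by simp [E3]⟩
  have hn0 : n ≠ 0 := by rintro rfl; simp at hn
  let b := OrthonormalBasis.fromOrthogonalSpanSingleton (𝕜 := ℝ) 2 hn0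
  refine ⟨b.repr.toContinuousLinearEquiv.toContinuousLinearMap ∘L (ℝ ∙ n)ᗮ.orthogonalProjectionOnto,
    fun y z => ?_⟩
  have h1 : ∀ y : E3, y = inner ℝ n y • n + (((ℝ ∙ n)ᗮ.orthogonalProjectionOnto y : (ℝ ∙ n)ᗮ) : E3) := by
    intro y
    have := (ℝ ∙ n).starProjection_add_starProjection_orthogonal y
    rw [Submodule.starProjection_unit_singleton ℝ hn] at this
    exact this.symm
  have h2 : ∀ w : (ℝ ∙ n)ᗮ, inner ℝ n (w : E3) = 0 := fun w =>
    Submodule.mem_orthogonal_singleton_iff_inner_right.1 w.2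
  have h3 : ∀ w : (ℝ ∙ n)ᗮ, inner ℝ (w : E3) n = 0 := fun w => by rw [real_inner_comm, h2]
  have h4 : inner ℝ y z = inner ℝ
      (inner ℝ n y • n + (((ℝ ∙ n)ᗮ.orthogonalProjectionOnto y : (ℝ ∙ n)ᗮ) : E3))
      (inner ℝ n z • n + (((ℝ ∙ n)ᗮ.orthogonalProjectionOnto z : (ℝ ∙ n)ᗮ) : E3)) := by
    rw [← h1, ← h1]
  rw [h4]
  simp only [inner_add_left, inner_add_right, inner_smul_left, inner_smul_right, h2, h3,
    real_inner_self_eq_norm_sq, hn, ContinuousLinearMap.comp_apply]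
  have h5 : ∀ v w, inner ℝ (b.repr.toContinuousLinearEquiv.toContinuousLinearMap v)
      (b.repr.toContinuousLinearEquiv.toContinuousLinearMap w) = inner ℝ (v : E3) (w : E3) :=
    fun v w => b.repr.inner_map_map v w
  rw [h5]
  simp only [conj_trivial]
  ring

/-- A chord u - w of the unit sphere is orthogonal to u + w, so its component along n equals, up to
sign, its product with (u + w)/2 - n, a vector of length at most δ. Near n the projection therefore
loses only a factor 1 - δ² in squared distance. -/
lemma dist_sq_le_of_orthogonal_projection {n : E3} {P : E3 →L[ℝ] E2}
    (hP : ∀ y z, inner ℝ (P y) (P z) + inner ℝ n y * inner ℝ n z = inner ℝ y z)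
    {δ : ℝ} {u w : E3} (hu : ‖u‖ = 1) (hw : ‖w‖ = 1) (hun : ‖u - n‖ ≤ δ) (hwn : ‖w - n‖ ≤ δ) :
    (1 - δ ^ 2) * dist u w ^ 2 ≤ dist (P u) (P w) ^ 2 := by
  have hδ : 0 ≤ δ := (norm_nonneg _).trans hun
  have h1 := hP (u - w) (u - w)
  rw [real_inner_self_eq_norm_sq, real_inner_self_eq_norm_sq, map_sub] at h1
  rw [dist_eq_norm, dist_eq_norm]
  have h2 : inner ℝ (u + w) (u - w) = 0 := by
    simp only [inner_add_left, inner_sub_right, real_inner_self_eq_norm_sq, hu, hw,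
      real_inner_comm u w]
    ring
  have h3 : inner ℝ n (u - w) = - (inner ℝ ((1/2 : ℝ) • ((u - n) + (w - n))) (u - w)) := by
    have : (1/2 : ℝ) • ((u - n) + (w - n)) = (1/2 : ℝ) • (u + w) - n := by
      module
    rw [this, inner_sub_left, inner_smul_left, h2]; simp
  have h4 : ‖(1/2 : ℝ) • ((u - n) + (w - n))‖ ≤ δ := by
    rw [norm_smul]
    have := norm_add_le (u - n) (w - n)
    norm_num
    linarith
  have h5 : |inner ℝ n (u - w)| ≤ δ * ‖u - w‖ := by
    rw [h3, abs_neg]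
    refine (abs_real_inner_le_norm _ _).trans ?_
    gcongr
  have h6 := sq_le_sq' (abs_le.1 h5).1 (abs_le.1 h5).2
  nlinarith

lemma lipschitz_of_orthogonal_projection {n : E3} {P : E3 →L[ℝ] E2}
    (hP : ∀ y z, inner ℝ (P y) (P z) + inner ℝ n y * inner ℝ n z = inner ℝ y z) :
    LipschitzWith 1 P := by
  refine LipschitzWith.of_dist_le_mul fun u w => ?_
  have h1 := hP (u - w) (u - w)
  rw [real_inner_self_eq_norm_sq, real_inner_self_eq_norm_sq, map_sub] at h1
  rw [dist_eq_norm, dist_eq_norm, NNReal.coe_one, one_mul]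
  exact abs_le_of_sq_le_sq' (by nlinarith) (norm_nonneg _) |>.2

/-! ### Weingarten matrices -/

/-- The matrix of the bilinear form `(v, w) ↦ ⟨B v, A w⟩` in the standard basis. -/
def pairingMatrix (A B : E2 →L[ℝ] E3) : Matrix (Fin 2) (Fin 2) ℝ :=
  Matrix.of fun i j => inner ℝ (B (EuclideanSpace.single i 1)) (A (EuclideanSpace.single j 1))

/-- The matrix `(g^{ik} h_{kj})` for a parametrization with derivative `A` and normal with
derivative `B`. -/
def weingartenMatrix (A B : E2 →L[ℝ] E3) : Matrix (Fin 2) (Fin 2) ℝ :=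
  (pairingMatrix A A)⁻¹ * pairingMatrix A B

lemma E2_eq_sum (v : E2) :
    v = v 0 • EuclideanSpace.single 0 1 + v 1 • EuclideanSpace.single 1 1 := by
  ext i; fin_cases i <;> simp

/-- The standard matrix of a linear map of the plane, with rows indexing the input. -/
def coordMatrix (T : E2 →L[ℝ] E2) : Matrix (Fin 2) (Fin 2) ℝ :=
  Matrix.of fun i k => T (EuclideanSpace.single i 1) k

lemma pairingMatrix_comp (A B : E2 →L[ℝ] E3) (T : E2 →L[ℝ] E2) :
    pairingMatrix (A ∘L T) (B ∘L T) =
      coordMatrix T * pairingMatrix A B * (coordMatrix T).transpose := by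
  ext i j
  simp only [pairingMatrix, coordMatrix, Matrix.of_apply, ContinuousLinearMap.comp_apply,
    Matrix.mul_apply, Fin.sum_univ_two, Matrix.transpose_apply]
  conv_lhs => rw [E2_eq_sum (T (EuclideanSpace.single i 1)), E2_eq_sum (T (EuclideanSpace.single j 1))]
  simp only [map_add, map_smul, inner_add_left, inner_add_right, inner_smul_left, inner_smul_right]
  simp
  ring

lemma det_coordMatrix (T : E2 →L[ℝ] E2) : (coordMatrix T).det = T.det := by
  rw [ContinuousLinearMap.det, ← LinearMap.det_toMatrix (EuclideanSpace.basisFun (Fin 2) ℝ).toBasis,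
    ← Matrix.det_transpose]
  congr 1

/-- A change of coordinates conjugates the Weingarten matrix, which makes its trace and determinant
independent of the chart. The transposes come from `coordMatrix` indexing inputs by rows. -/
lemma weingartenMatrix_comp (A B : E2 →L[ℝ] E3) (T : E2 →L[ℝ] E2) (hT : T.det ≠ 0) :
    weingartenMatrix (A ∘L T) (B ∘L T) =
      ((coordMatrix T).transpose)⁻¹ * weingartenMatrix A B * (coordMatrix T).transpose := by
  have h : IsUnit (coordMatrix T).det := by rw [det_coordMatrix]; exact hT.isUnit
  rw [weingartenMatrix, pairingMatrix_comp, pairingMatrix_comp, Matrix.mul_inv_rev,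
    Matrix.mul_inv_rev, weingartenMatrix]
  simp only [Matrix.mul_assoc, Matrix.nonsing_inv_mul_cancel_left _ _ h]

lemma trace_weingartenMatrix_comp (A B : E2 →L[ℝ] E3) (T : E2 →L[ℝ] E2) (hT : T.det ≠ 0) :
    (weingartenMatrix (A ∘L T) (B ∘L T)).trace = (weingartenMatrix A B).trace := by
  have h : IsUnit (coordMatrix T).transpose.det := by
    rw [Matrix.det_transpose, det_coordMatrix]; exact hT.isUnit
  rw [weingartenMatrix_comp _ _ _ hT, Matrix.trace_mul_comm, Matrix.mul_nonsing_inv_cancel_left _ _ h]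

lemma det_weingartenMatrix_comp (A B : E2 →L[ℝ] E3) (T : E2 →L[ℝ] E2) (hT : T.det ≠ 0) :
    (weingartenMatrix (A ∘L T) (B ∘L T)).det = (weingartenMatrix A B).det := by
  have h : IsUnit (coordMatrix T).transpose := by
    rw [Matrix.isUnit_iff_isUnit_det, Matrix.det_transpose, det_coordMatrix]; exact hT.isUnit
  rw [weingartenMatrix_comp _ _ _ hT]
  exact Matrix.det_conj' h _

lemma pairingMatrix_eq_of_projection {n : E3} {P : E3 →L[ℝ] E2}
    (hP : ∀ y z, inner ℝ (P y) (P z) + inner ℝ n y * inner ℝ n z = inner ℝ y z)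
    {A : E2 →L[ℝ] E3} (B : E2 →L[ℝ] E3) (hA : ∀ v, inner ℝ n (A v) = 0) :
    pairingMatrix A B = coordMatrix (P ∘L B) * (coordMatrix (P ∘L A)).transpose := by
  ext i j
  simp only [pairingMatrix, coordMatrix, Matrix.of_apply, ContinuousLinearMap.comp_apply,
    Matrix.mul_apply, Fin.sum_univ_two, Matrix.transpose_apply]
  rw [← hP, hA, mul_zero, add_zero]
  simp [PiLp.inner_apply, mul_comm]

lemma det_projection_comp_ne_zero {n : E3} {P : E3 →L[ℝ] E2}
    (hP : ∀ y z, inner ℝ (P y) (P z) + inner ℝ n y * inner ℝ n z = inner ℝ y z)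
    {A : E2 →L[ℝ] E3} (hA : ∀ v, inner ℝ n (A v) = 0) (hinj : Function.Injective A) :
    (P ∘L A).det ≠ 0 := by
  have hker : LinearMap.ker (P ∘L A : E2 →ₗ[ℝ] E2) = ⊥ := by
    rw [LinearMap.ker_eq_bot']
    intro v hv
    have h := hP (A v) (A v)
    have hv' : P (A v) = 0 := hv
    rw [hv', hA, inner_zero_left, mul_zero, add_zero] at h
    exact hinj (by rw [inner_self_eq_zero.1 h.symm, map_zero])
  intro h0
  have := LinearMap.bot_lt_ker_of_det_eq_zero (f := (P ∘L A : E2 →ₗ[ℝ] E2)) h0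
  rw [hker] at this
  exact lt_irrefl _ this

/-- With a and b the coordinate matrices of P∘A and P∘B, g = a aᵀ and h = b aᵀ. The Gauss curvature
thus becomes the Jacobian of a map between plane regions. -/
lemma det_weingartenMatrix_eq {n : E3} {P : E3 →L[ℝ] E2}
    (hP : ∀ y z, inner ℝ (P y) (P z) + inner ℝ n y * inner ℝ n z = inner ℝ y z)
    {A : E2 →L[ℝ] E3} (B : E2 →L[ℝ] E3) (hA : ∀ v, inner ℝ n (A v) = 0)
    (hinj : Function.Injective A) :
    (weingartenMatrix A B).det = (P ∘L B).det / (P ∘L A).det := by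
  have h := det_projection_comp_ne_zero hP hA hinj
  rw [weingartenMatrix, Matrix.det_mul, Matrix.det_nonsing_inv, pairingMatrix_eq_of_projection hP _ hA,
    pairingMatrix_eq_of_projection hP _ hA, Matrix.det_mul, Matrix.det_mul, Matrix.det_transpose,
    det_coordMatrix, det_coordMatrix, Ring.inverse_eq_inv']
  field_simp

lemma det_pairingMatrix_pos {n : E3} (hn : ‖n‖ = 1)
    {A : E2 →L[ℝ] E3} (hA : ∀ v, inner ℝ n (A v) = 0) (hinj : Function.Injective A) :
    0 < (pairingMatrix A A).det := by
  obtain ⟨P, hP⟩ := exists_orthogonal_projection hn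
  rw [pairingMatrix_eq_of_projection hP _ hA, Matrix.det_mul, Matrix.det_transpose, det_coordMatrix]
  exact mul_self_pos.2 (det_projection_comp_ne_zero hP hA hinj)

/-! ### Algebra of the two fundamental forms -/

/-- This is (κ₁ - κ₂)² as an explicit sum of two squares, without diagonalization; both squares
vanish only if h is proportional to g. -/
lemma trace_sq_sub_four_det {g h : Matrix (Fin 2) (Fin 2) ℝ} (hg : g 1 0 = g 0 1)
    (hh : h 1 0 = h 0 1) (hE : g 0 0 ≠ 0) (hD : g.det ≠ 0) :
    (g⁻¹ * h).trace ^ 2 - 4 * (g⁻¹ * h).det =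
      ((g 0 0 * (g 1 1 * h 0 0 - 2 * g 0 1 * h 0 1 + g 0 0 * h 1 1) - 2 * g.det * h 0 0) ^ 2
        + 4 * g.det * (g 0 0 * h 0 1 - g 0 1 * h 0 0) ^ 2) / (g 0 0 * g.det) ^ 2 ∧
    (g⁻¹ * h).trace = (g 1 1 * h 0 0 - 2 * g 0 1 * h 0 1 + g 0 0 * h 1 1) / g.det := by
  have htr : (g⁻¹ * h).trace = (g 1 1 * h 0 0 - 2 * g 0 1 * h 0 1 + g 0 0 * h 1 1) / g.det := by
    rw [Matrix.inv_def, Matrix.adjugate_fin_two, Ring.inverse_eq_inv']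
    rw [Matrix.trace_fin_two, Matrix.mul_apply, Matrix.mul_apply, Fin.sum_univ_two,
      Fin.sum_univ_two]
    simp [hg, hh]
    field_simp
    ring
  refine ⟨?_, htr⟩
  rw [htr, Matrix.det_mul, Matrix.det_nonsing_inv, Ring.inverse_eq_inv']
  field_simp
  rw [Matrix.det_fin_two, Matrix.det_fin_two, hg, hh]
  ring

lemma four_det_le_trace_sq {g h : Matrix (Fin 2) (Fin 2) ℝ} (hg : g 1 0 = g 0 1)
    (hh : h 1 0 = h 0 1) (hE : 0 < g 0 0) (hD : 0 < g.det) :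
    4 * (g⁻¹ * h).det ≤ (g⁻¹ * h).trace ^ 2 := by
  have := (trace_sq_sub_four_det hg hh hE.ne' hD.ne').1
  have h2 : 0 ≤ (g⁻¹ * h).trace ^ 2 - 4 * (g⁻¹ * h).det := by rw [this]; positivity
  linarith

lemma eq_smul_of_four_det_eq {g h : Matrix (Fin 2) (Fin 2) ℝ} (hg : g 1 0 = g 0 1)
    (hh : h 1 0 = h 0 1) (hE : 0 < g 0 0) (hD : 0 < g.det)
    (he : 4 * (g⁻¹ * h).det = (g⁻¹ * h).trace ^ 2) :
    h = ((g⁻¹ * h).trace / 2) • g := by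
  obtain ⟨h1, h2⟩ := trace_sq_sub_four_det hg hh hE.ne' hD.ne'
  rw [he, sub_self, eq_comm, div_eq_zero_iff] at h1
  have h3 := h1.resolve_right (by positivity)
  have h4 : (g 0 0 * h 0 1 - g 0 1 * h 0 0) = 0 := by
    have : 4 * g.det * (g 0 0 * h 0 1 - g 0 1 * h 0 0) ^ 2 = 0 := by
      have : 0 ≤ 4 * g.det * (g 0 0 * h 0 1 - g 0 1 * h 0 0) ^ 2 := by positivity
      nlinarith [sq_nonneg (g 0 0 * (g 1 1 * h 0 0 - 2 * g 0 1 * h 0 1 + g 0 0 * h 1 1) - 2 * g.det * h 0 0)]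
    rcases mul_eq_zero.1 this with h | h
    · linarith
    · exact pow_eq_zero_iff (two_ne_zero) |>.1 h
  have h5 : g 0 0 * (g 1 1 * h 0 0 - 2 * g 0 1 * h 0 1 + g 0 0 * h 1 1) - 2 * g.det * h 0 0 = 0 := by
    rw [h4] at h3
    simpa using h3
  have htr : (g⁻¹ * h).trace / 2 = h 0 0 / g 0 0 := by
    rw [h2]
    field_simp
    linarith
  have hM : h 0 1 = h 0 0 / g 0 0 * g 0 1 := by field_simp; linarith
  have hN : h 1 1 = h 0 0 / g 0 0 * g 1 1 := by
    rw [Matrix.det_fin_two, hg, hM] at h5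
    field_simp
    field_simp at h5
    have : g 0 0 * (g 0 0 * h 1 1 - h 0 0 * g 1 1) = 0 := by linarith
    have := (mul_eq_zero.1 this).resolve_left hE.ne'
    linarith
  rw [htr]
  ext i j
  fin_cases i <;> fin_cases j
  · simp; field_simp
  · simpa using hM
  · simp [hg, hh]; simpa using hM
  · simpa using hN

lemma pairingMatrix_self_symm (A : E2 →L[ℝ] E3) :
    pairingMatrix A A 1 0 = pairingMatrix A A 0 1 := by
  simp [pairingMatrix, real_inner_comm]

lemma pairingMatrix_self_pos {A : E2 →L[ℝ] E3} (hinj : Function.Injective A) :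
    0 < pairingMatrix A A 0 0 := by
  simp only [pairingMatrix, Matrix.of_apply]
  rw [real_inner_self_eq_norm_sq]
  have : A (EuclideanSpace.single 0 1) ≠ 0 := fun h => by
    have := hinj (h.trans (map_zero A).symm)
    have := congrArg (fun v : E2 => v 0) this
    simp at this
  positivity

lemma inner_eq_of_pairingMatrix_eq {A B C : E2 →L[ℝ] E3}
    (h : pairingMatrix A B = pairingMatrix A C) (v w : E2) :
    inner ℝ (B v) (A w) = inner ℝ (C v) (A w) := by
  have h' : ∀ i j, inner ℝ (B (EuclideanSpace.single i 1)) (A (EuclideanSpace.single j 1)) =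
      inner ℝ (C (EuclideanSpace.single i 1)) (A (EuclideanSpace.single j 1)) := fun i j =>
    congrFun (congrFun h i) j
  rw [E2_eq_sum v, E2_eq_sum w]
  simp only [map_add, map_smul, inner_add_left, inner_add_right, inner_smul_left, inner_smul_right,
    h']

lemma pairingMatrix_smul (A B : E2 →L[ℝ] E3) (c : ℝ) :
    pairingMatrix A (c • B) = c • pairingMatrix A B := by
  ext i j; simp [pairingMatrix, inner_smul_left]

lemma weingartenMatrix_smul_self {A : E2 →L[ℝ] E3} (h : 0 < (pairingMatrix A A).det) (c : ℝ) :
    weingartenMatrix A (c • A) = c • 1 := by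
  rw [weingartenMatrix, pairingMatrix_smul, Matrix.mul_smul, Matrix.nonsing_inv_mul]
  exact h.ne'.isUnit

/-- The quadratic t ↦ h(t e₀ + e₁, t e₀ + e₁) is nonnegative, so its discriminant is not positive.
-/
lemma det_pairingMatrix_nonneg {A B : E2 →L[ℝ] E3} (hs : pairingMatrix A B 1 0 = pairingMatrix A B 0 1)
    (h : ∀ v, 0 ≤ inner ℝ (B v) (A v)) : 0 ≤ (pairingMatrix A B).det := by
  have h1 : ∀ t : ℝ, 0 ≤ pairingMatrix A B 0 0 * (t * t) + 2 * pairingMatrix A B 0 1 * t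
      + pairingMatrix A B 1 1 := by
    intro t
    have := h (t • EuclideanSpace.single 0 1 + EuclideanSpace.single 1 1)
    simp only [pairingMatrix, Matrix.of_apply] at hs ⊢
    simp only [map_add, map_smul, inner_add_left, inner_add_right, inner_smul_left,
      inner_smul_right, hs, conj_trivial] at this
    linarith
  have := discrim_le_zero h1
  rw [discrim] at this
  rw [Matrix.det_fin_two, hs]
  nlinarith

/-- By dimension the image of `A` is all of n^⊥, so a vector orthogonal to it is a multiple of n. -/
lemma eq_of_inner_eq {n : E3} (hn : ‖n‖ = 1) {A : E2 →L[ℝ] E3} (hA : ∀ v, inner ℝ n (A v) = 0)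
    (hinj : Function.Injective A) {y : E3} (h1 : ∀ w, inner ℝ y (A w) = 0) :
    y = (inner ℝ n y : ℝ) • n := by
  obtain ⟨P, hP⟩ := exists_orthogonal_projection hn
  have hdet := det_projection_comp_ne_zero hP hA hinj
  have hsurj : Function.Surjective (P ∘L A) := by
    intro u
    obtain ⟨v, hv⟩ := ((P ∘L A).toContinuousLinearEquivOfDetNeZero hdet).surjective u
    exact ⟨v, hv⟩
  have hz : ∀ u, inner ℝ (P y) u = 0 := by
    intro u
    obtain ⟨v, rfl⟩ := hsurj u
    have := hP y (A v)
    rw [hA, mul_zero, add_zero, h1] at this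
    exact this
  have h0 : P y = 0 := by simpa using hz (P y)
  set z := y - (inner ℝ n y : ℝ) • n with hzdef
  have hnz : inner ℝ n z = 0 := by
    rw [hzdef, inner_sub_right, inner_smul_right, real_inner_self_eq_norm_sq, hn]; ring
  have hyz : inner ℝ y z = 0 := by
    rw [← hP, h0, inner_zero_left, hnz]; ring
  have : inner ℝ z z = 0 := by
    conv_lhs => rw [hzdef, inner_sub_left, inner_smul_left, ← hzdef, hyz, hnz]
    simp
  exact sub_eq_zero.1 (inner_self_eq_zero.1 this)

/-! ### Comparison of the areas of a surface and of its Gauss image -/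

/-- P∘X is a local diffeomorphism, so the projected image contains an open set, and projecting does
not increase area. -/
lemma exists_nhds_measure_image_pos {X : E2 → E3} {A : E2 →L[ℝ] E3} {q : E2} {n : E3}
    (hX : HasStrictFDerivAt X A q) (hn : ‖n‖ = 1) (hA : ∀ v, inner ℝ n (A v) = 0)
    (hinj : Function.Injective A) {V : Set E2} (hV : V ∈ 𝓝 q) :
    0 < (μHE[2] : Measure E3) (X '' V) := by
  obtain ⟨P, hP⟩ := exists_orthogonal_projection hn
  have hdet := det_projection_comp_ne_zero hP hA hinj
  let e := (P ∘L A).toContinuousLinearEquivOfDetNeZero hdet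
  have hPX : HasStrictFDerivAt (P ∘ X) (e : E2 →L[ℝ] E2) q := P.hasStrictFDerivAt.comp q hX
  have h1 : P '' (X '' V) ∈ 𝓝 (P (X q)) := by
    rw [← image_comp]
    have := hPX.map_nhds_eq_of_equiv
    rw [show P (X q) = (P ∘ X) q from rfl, ← this]
    exact image_mem_map hV
  have h2 := euclideanHausdorffMeasure_image_le_of_lipschitzOn
    ((lipschitz_of_orthogonal_projection hP).lipschitzOnWith (s := X '' V))
  rw [EuclideanSpace.euclideanHausdorffMeasure_eq_volume] at h2
  refine lt_of_lt_of_le (Measure.measure_pos_of_mem_nhds volume h1) (h2.trans ?_)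
  simp

/-- With g a local inverse of P∘X, the map P∘N∘g carries the projected surface to the projected
Gauss image, and its Jacobian at the base point is the Gauss curvature up to sign. Undoing the
projection on the Gauss image costs a factor close to 1; on the surface only the 1-Lipschitz bound
is needed. -/
lemma exists_nhds_measure_image_le {X N : E2 → E3} {A B : E2 →L[ℝ] E3} {q : E2}
    (hX : HasStrictFDerivAt X A q) (hN : HasStrictFDerivAt N B q)
    (hN1 : ∀ᶠ z in 𝓝 q, ‖N z‖ = 1) (hA : ∀ v, inner ℝ (N q) (A v) = 0)
    (hinj : Function.Injective A) {t : ℝ≥0} (ht : |(weingartenMatrix A B).det| < t) :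
    ∃ V ∈ 𝓝 q, ∀ s ⊆ V, (μHE[2] : Measure E3) (N '' s) ≤ t * (μHE[2] : Measure E3) (X '' s) := by
  have hn : ‖N q‖ = 1 := hN1.self_of_nhds
  obtain ⟨P, hP⟩ := exists_orthogonal_projection hn
  have hdet := det_projection_comp_ne_zero hP hA hinj
  let e := (P ∘L A).toContinuousLinearEquivOfDetNeZero hdet
  have hPX : HasStrictFDerivAt (P ∘ X) (e : E2 →L[ℝ] E2) q := P.hasStrictFDerivAt.comp q hX
  have hPN : HasStrictFDerivAt (P ∘ N) (P ∘L B) q := P.hasStrictFDerivAt.comp q hN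
  set g := hPX.localInverse (P ∘ X) e q with hg
  have hgd : HasStrictFDerivAt g (e.symm : E2 →L[ℝ] E2) ((P ∘ X) q) := hPX.to_localInverse
  have hgq : g ((P ∘ X) q) = q := hPX.localInverse_apply_image
  have hf : HasStrictFDerivAt ((P ∘ N) ∘ g) ((P ∘L B) ∘L (e.symm : E2 →L[ℝ] E2)) ((P ∘ X) q) := by
    have h : HasStrictFDerivAt (P ∘ N) (P ∘L B) (g ((P ∘ X) q)) := by rwa [hgq]
    exact h.comp _ hgd
  have hdS : |((P ∘L B) ∘L (e.symm : E2 →L[ℝ] E2)).det| = |(weingartenMatrix A B).det| := by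
    rw [det_weingartenMatrix_eq hP B hA hinj]
    congr 1
    have h1 : ((P ∘L B) ∘L (e.symm : E2 →L[ℝ] E2)).det =
        (P ∘L B).det * (e.symm : E2 →L[ℝ] E2).det := LinearMap.det_comp _ _
    have h2 : (e.symm : E2 →L[ℝ] E2).det = ((P ∘L A).det)⁻¹ := e.det_coe_symm
    rw [h1, h2, div_eq_mul_inv]
  -- The gap between |det| and `t` is shared: `m` absorbs the error of linearization, and the rest
  -- of the gap pays for the inverse projection on the sphere.
  obtain ⟨m, hm1, hm2⟩ : ∃ m : ℝ≥0, |(weingartenMatrix A B).det| < m ∧ m < t := by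
    obtain ⟨m, h1, h2⟩ := exists_between ht
    exact ⟨NNReal.mk m ((abs_nonneg _).trans h1.le), h1, h2⟩
  have hmS : ENNReal.ofReal |((P ∘L B) ∘L (e.symm : E2 →L[ℝ] E2)).det| < m := by
    rw [hdS, ENNReal.ofReal_lt_iff_lt_toReal (abs_nonneg _) (by simp)]
    exact hm1
  obtain ⟨η, hη, hη0⟩ := ((addHaar_image_le_mul_of_det_lt volume _ hmS).and
    self_mem_nhdsWithin).exists
  obtain ⟨W, hW, hWa⟩ := hf.approximates_deriv_on_nhds (Or.inr hη0)
  -- the Lipschitz constant of the inverse of the projection restricted to the sphere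
  obtain ⟨δ, hδ0, hδ1, hδ⟩ : ∃ δ : ℝ, 0 < δ ∧ δ < 1 ∧ m / (1 - δ ^ 2) < t := by
    have h1 : Tendsto (fun δ : ℝ => (m : ℝ) / (1 - δ ^ 2)) (𝓝[>] 0) (𝓝 (m : ℝ)) := by
      have : ContinuousAt (fun δ : ℝ => (m : ℝ) / (1 - δ ^ 2)) 0 := by
        apply ContinuousAt.div <;> first | fun_prop | norm_num
      have h := this.tendsto.mono_left (nhdsWithin_le_nhds (s := Ioi 0))
      simpa using h
    have h2 := h1.eventually_lt_const (show (m : ℝ) < t from hm2)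
    have h3 : ∀ᶠ δ : ℝ in 𝓝[>] 0, δ < 1 := nhdsWithin_le_nhds (Iio_mem_nhds one_pos)
    obtain ⟨δ, ⟨h4, h5⟩, h6⟩ := ((h2.and h3).and self_mem_nhdsWithin).exists
    exact ⟨δ, h6, h5, h4⟩
  have hδp : 0 < 1 - δ ^ 2 := by nlinarith
  set K : ℝ≥0 := NNReal.mk (Real.sqrt (1 - δ ^ 2))⁻¹ (by positivity) with hK
  have hK2 : (K : ℝ) ^ 2 = (1 - δ ^ 2)⁻¹ := by
    rw [hK, NNReal.coe_mk, inv_pow, Real.sq_sqrt hδp.le]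
  have hmt : (K : ℝ≥0∞) ^ 2 * m ≤ t := by
    have h : K ^ 2 * m ≤ t := by
      rw [← NNReal.coe_le_coe, NNReal.coe_mul, NNReal.coe_pow, hK2]
      refine le_trans (le_of_eq ?_) hδ.le
      field_simp
    exact_mod_cast h
  have hNc : ∀ᶠ z in 𝓝 q, ‖N z - N q‖ ≤ δ := by
    have := hN.hasFDerivAt.continuousAt
    filter_upwards [this (Metric.closedBall_mem_nhds _ hδ0)] with z hz
    simpa [dist_eq_norm] using hz
  have hWX : ∀ᶠ z in 𝓝 q, (P ∘ X) z ∈ W := hPX.hasFDerivAt.continuousAt hW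
  refine ⟨{z | ((‖N z‖ = 1 ∧ ‖N z - N q‖ ≤ δ) ∧ (P ∘ X) z ∈ W) ∧ g ((P ∘ X) z) = z},
    ((hN1.and hNc).and hWX).and hPX.eventually_left_inverse, fun s hs => ?_⟩
  have h1 : (μHE[2] : Measure E3) (N '' s) ≤ (K : ℝ≥0∞) ^ 2 * volume (P '' (N '' s)) := by
    rw [← EuclideanSpace.euclideanHausdorffMeasure_eq_volume]
    apply euclideanHausdorffMeasure_le_of_dist_le
    rintro _ ⟨u, hu, rfl⟩ _ ⟨w, hw, rfl⟩
    have := dist_sq_le_of_orthogonal_projection hP (hs hu).1.1.1 (hs hw).1.1.1 (hs hu).1.1.2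
      (hs hw).1.1.2
    refine (abs_le_of_sq_le_sq' ?_ (by positivity)).2
    rw [mul_pow, hK2, inv_mul_eq_div, le_div_iff₀ hδp]
    linarith
  have h2 : P '' (N '' s) = ((P ∘ N) ∘ g) '' ((P ∘ X) '' s) := by
    rw [← image_comp, ← image_comp]
    refine image_congr fun z hz => ?_
    simp only [Function.comp_apply]
    have := (hs hz).2
    simp only [Function.comp_apply] at this
    rw [this]
  have h3 : volume (((P ∘ N) ∘ g) '' ((P ∘ X) '' s)) ≤ m * volume ((P ∘ X) '' s) := by
    refine hη _ _ (hWa.mono_set ?_)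
    rintro _ ⟨z, hz, rfl⟩
    exact (hs hz).1.2
  have h4 : volume ((P ∘ X) '' s) ≤ (μHE[2] : Measure E3) (X '' s) := by
    rw [image_comp, ← EuclideanSpace.euclideanHausdorffMeasure_eq_volume]
    refine (euclideanHausdorffMeasure_image_le_of_lipschitzOn
      (lipschitz_of_orthogonal_projection hP).lipschitzOnWith).trans ?_
    simp
  calc _ ≤ (K : ℝ≥0∞) ^ 2 * volume (P '' (N '' s)) := h1
    _ ≤ (K : ℝ≥0∞) ^ 2 * (m * (μHE[2] : Measure E3) (X '' s)) := by
      rw [h2]; gcongr; exact h3.trans (by gcongr)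
    _ ≤ t * (μHE[2] : Measure E3) (X '' s) := by rw [← mul_assoc]; gcongr

/-! ### Parametrized pieces of convex surfaces -/

/-- `X : W → ℝ³` is a smooth immersion of the open set `W` of the plane, with unit normal `N` for
which its second fundamental form is positive semidefinite. -/
structure IsConvexPatch (X N : E2 → E3) (W : Set E2) : Prop where
  isOpen : IsOpen W
  smooth : ContDiffOn ℝ ∞ X W
  smooth_normal : ContDiffOn ℝ ∞ N W
  injective : ∀ q ∈ W, Function.Injective (fderiv ℝ X q)
  norm_normal : ∀ q ∈ W, ‖N q‖ = 1
  orthogonal : ∀ q ∈ W, ∀ v, inner ℝ (N q) (fderiv ℝ X q v) = 0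
  convex : ∀ q ∈ W, ∀ v, 0 ≤ inner ℝ (fderiv ℝ N q v) (fderiv ℝ X q v)

/-- A positive second derivative would make t a local minimum as well, so f would be locally
constant with zero second derivative. -/
lemma second_deriv_nonpos_of_isLocalMax {f f' : ℝ → ℝ} {a t : ℝ}
    (h1 : ∀ᶠ s in 𝓝 t, HasDerivAt f (f' s) s) (h2 : HasDerivAt f' a t) (hmax : IsLocalMax f t) :
    a ≤ 0 := by
  by_contra! hpos
  have hd : deriv f =ᶠ[𝓝 t] f' := by filter_upwards [h1] with s hs using hs.deriv
  have hdd : deriv (deriv f) t = a := by rw [hd.deriv_eq, h2.deriv]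
  have hmin := isLocalMin_of_deriv_deriv_pos (by rwa [hdd]) hmax.deriv_eq_zero
    h1.self_of_nhds.continuousAt
  have hconst : f =ᶠ[𝓝 t] fun _ => f t := by
    filter_upwards [hmin, hmax] with s hs1 hs2 using le_antisymm hs2 hs1
  have h3 := hconst.deriv.deriv_eq
  rw [hdd] at h3
  simp at h3
  linarith

namespace IsConvexPatch

variable {X N : E2 → E3} {W : Set E2} {q : E2}

lemma contDiffAt (h : IsConvexPatch X N W) (hq : q ∈ W) : ContDiffAt ℝ ∞ X q :=
  h.smooth.contDiffAt (h.isOpen.mem_nhds hq)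

lemma contDiffAt_normal (h : IsConvexPatch X N W) (hq : q ∈ W) : ContDiffAt ℝ ∞ N q :=
  h.smooth_normal.contDiffAt (h.isOpen.mem_nhds hq)

lemma mono (h : IsConvexPatch X N W) {W' : Set E2} (ho : IsOpen W') (hs : W' ⊆ W) :
    IsConvexPatch X N W' where
  isOpen := ho
  smooth := h.smooth.mono hs
  smooth_normal := h.smooth_normal.mono hs
  injective q hq := h.injective q (hs hq)
  norm_normal q hq := h.norm_normal q (hs hq)
  orthogonal q hq := h.orthogonal q (hs hq)
  convex q hq := h.convex q (hs hq)

lemma hasStrictFDerivAt (h : IsConvexPatch X N W) (hq : q ∈ W) :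
    HasStrictFDerivAt X (fderiv ℝ X q) q :=
  (h.contDiffAt hq).hasStrictFDerivAt (by simp)

lemma hasStrictFDerivAt_normal (h : IsConvexPatch X N W) (hq : q ∈ W) :
    HasStrictFDerivAt N (fderiv ℝ N q) q :=
  (h.contDiffAt_normal hq).hasStrictFDerivAt (by simp)

lemma differentiableAt_fderiv {Y : E2 → E3} (h : ContDiffAt ℝ ∞ Y q) :
    DifferentiableAt ℝ (fderiv ℝ Y) q :=
  (h.fderiv_right (m := 1) (by norm_cast)).differentiableAt (by simp)

lemma fderiv_fderiv_symm {Y : E2 → E3} (h : ContDiffAt ℝ ∞ Y q) (v w : E2) :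
    fderiv ℝ (fderiv ℝ Y) q v w = fderiv ℝ (fderiv ℝ Y) q w v :=
  (h.isSymmSndFDerivAt (by simp; exact WithTop.coe_le_coe.2 le_top)).eq v w

lemma inner_normal_fderiv_normal (h : IsConvexPatch X N W) (hq : q ∈ W) (v : E2) :
    inner ℝ (N q) (fderiv ℝ N q v) = 0 := by
  have hd := (h.hasStrictFDerivAt_normal hq).hasFDerivAt.differentiableAt
  have h1 : (fun z => (inner ℝ (N z) (N z) : ℝ)) =ᶠ[𝓝 q] fun _ => 1 := by
    filter_upwards [h.isOpen.mem_nhds hq] with z hz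
    rw [real_inner_self_eq_norm_sq, h.norm_normal z hz]; norm_num
  have h2 := congrArg (fun L : E2 →L[ℝ] ℝ => L v) h1.fderiv_eq
  simp only [fderiv_inner_apply ℝ hd hd, fderiv_fun_const] at h2
  rw [real_inner_comm (N q) (fderiv ℝ N q v)] at h2
  simp at h2
  linarith

/-- Differentiate ⟨N, DX v⟩ = 0 in the direction w. Symmetry of D²X then gives the symmetry of h. -/
lemma inner_fderiv_normal_eq (h : IsConvexPatch X N W) (hq : q ∈ W) (v w : E2) :
    inner ℝ (fderiv ℝ N q w) (fderiv ℝ X q v) = - inner ℝ (N q) (fderiv ℝ (fderiv ℝ X) q w v) := by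
  have hd := (h.hasStrictFDerivAt_normal hq).hasFDerivAt.differentiableAt
  have hd2 := differentiableAt_fderiv (h.contDiffAt hq)
  have h1 : (fun z => (inner ℝ (N z) (fderiv ℝ X z v) : ℝ)) =ᶠ[𝓝 q] fun _ => 0 := by
    filter_upwards [h.isOpen.mem_nhds hq] with z hz
    rw [h.orthogonal z hz]
  have h2 := congrArg (fun L : E2 →L[ℝ] ℝ => L w) h1.fderiv_eq
  have h3 : DifferentiableAt ℝ (fun z => fderiv ℝ X z v) q := hd2.clm_apply (by fun_prop)
  simp only [fderiv_inner_apply ℝ hd h3, fderiv_fun_const] at h2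
  rw [fderiv_clm_apply hd2 (by fun_prop)] at h2
  simp at h2
  linarith

lemma pairingMatrix_symm (h : IsConvexPatch X N W) (hq : q ∈ W) :
    pairingMatrix (fderiv ℝ X q) (fderiv ℝ N q) 1 0 =
      pairingMatrix (fderiv ℝ X q) (fderiv ℝ N q) 0 1 := by
  simp only [pairingMatrix, Matrix.of_apply]
  rw [h.inner_fderiv_normal_eq hq, h.inner_fderiv_normal_eq hq,
    fderiv_fderiv_symm (h.contDiffAt hq)]

lemma det_pairingMatrix_pos (h : IsConvexPatch X N W) (hq : q ∈ W) :
    0 < (pairingMatrix (fderiv ℝ X q) (fderiv ℝ X q)).det :=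
  CapillarySurface.det_pairingMatrix_pos (h.norm_normal q hq) (h.orthogonal q hq) (h.injective q hq)

lemma four_det_le (h : IsConvexPatch X N W) (hq : q ∈ W) :
    4 * (weingartenMatrix (fderiv ℝ X q) (fderiv ℝ N q)).det ≤
      (weingartenMatrix (fderiv ℝ X q) (fderiv ℝ N q)).trace ^ 2 :=
  four_det_le_trace_sq (pairingMatrix_self_symm _) (h.pairingMatrix_symm hq)
    (pairingMatrix_self_pos (h.injective q hq)) (h.det_pairingMatrix_pos hq)

lemma det_nonneg (h : IsConvexPatch X N W) (hq : q ∈ W) :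
    0 ≤ (weingartenMatrix (fderiv ℝ X q) (fderiv ℝ N q)).det := by
  rw [weingartenMatrix, Matrix.det_mul, Matrix.det_nonsing_inv, Ring.inverse_eq_inv']
  exact mul_nonneg (inv_nonneg.2 (h.det_pairingMatrix_pos hq).le)
    (det_pairingMatrix_nonneg (h.pairingMatrix_symm hq) (h.convex q hq))

lemma fderiv_normal_eq_of_inner (h : IsConvexPatch X N W) (hq : q ∈ W) {c : ℝ}
    (he : ∀ v w, inner ℝ (fderiv ℝ N q v) (fderiv ℝ X q w) =
      inner ℝ ((c • fderiv ℝ X q) v) (fderiv ℝ X q w)) :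
    fderiv ℝ N q = c • fderiv ℝ X q := by
  ext1 v
  have h1 := eq_of_inner_eq (h.norm_normal q hq) (h.orthogonal q hq) (h.injective q hq)
    (y := fderiv ℝ N q v - (c • fderiv ℝ X q) v) (fun w => by rw [inner_sub_left, he, sub_self])
  rw [inner_sub_right, h.inner_normal_fderiv_normal hq, _root_.smul_apply,
    inner_smul_right, h.orthogonal q hq] at h1
  simpa [sub_eq_zero] using h1

lemma fderiv_normal_eq_smul (h : IsConvexPatch X N W) (hq : q ∈ W)
    (he : 4 * (weingartenMatrix (fderiv ℝ X q) (fderiv ℝ N q)).det =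
      (weingartenMatrix (fderiv ℝ X q) (fderiv ℝ N q)).trace ^ 2) :
    fderiv ℝ N q =
      ((weingartenMatrix (fderiv ℝ X q) (fderiv ℝ N q)).trace / 2) • fderiv ℝ X q := by
  refine h.fderiv_normal_eq_of_inner hq fun v w => inner_eq_of_pairingMatrix_eq ?_ v w
  rw [pairingMatrix_smul]
  exact eq_smul_of_four_det_eq (pairingMatrix_self_symm _) (h.pairingMatrix_symm hq)
    (pairingMatrix_self_pos (h.injective q hq)) (h.det_pairingMatrix_pos hq) he

lemma trace_of_fderiv_normal_eq_smul (h : IsConvexPatch X N W) (hq : q ∈ W) {c : ℝ}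
    (he : fderiv ℝ N q = c • fderiv ℝ X q) :
    (weingartenMatrix (fderiv ℝ X q) (fderiv ℝ N q)).trace = 2 * c := by
  rw [he, weingartenMatrix_smul_self (h.det_pairingMatrix_pos hq), Matrix.trace_smul,
    Matrix.trace_one]
  simp [mul_comm]

/-- The normal at an interior maximum of a height function; if it has the wrong direction, the
Gauss curvature vanishes there. -/
lemma normal_eq_or_of_isLocalMax (h : IsConvexPatch X N W) (hq : q ∈ W) {n : E3} (hn : ‖n‖ = 1)
    (hmax : IsLocalMax (fun z => (inner ℝ (X z) n : ℝ)) q) :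
    N q = n ∨ (N q = -n ∧ (weingartenMatrix (fderiv ℝ X q) (fderiv ℝ N q)).det = 0) := by
  have hd := (h.hasStrictFDerivAt hq).hasFDerivAt.differentiableAt
  have h1 : ∀ v, inner ℝ n (fderiv ℝ X q v) = 0 := by
    intro v
    have h2 := congrArg (fun L : E2 →L[ℝ] ℝ => L v) hmax.fderiv_eq_zero
    simp only [fderiv_inner_apply ℝ hd (differentiableAt_const n), fderiv_fun_const] at h2
    rw [real_inner_comm]
    simpa using h2
  have h2 := eq_of_inner_eq (h.norm_normal q hq) (h.orthogonal q hq) (h.injective q hq) h1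
  have h3 : |inner ℝ (N q) n| = 1 := by
    have := congrArg norm h2
    rw [norm_smul, h.norm_normal q hq, hn, mul_one, Real.norm_eq_abs] at this
    exact this.symm
  rcases eq_or_eq_neg_of_abs_eq h3 with h4 | h4
  · left; rw [h4, one_smul] at h2; exact h2.symm
  right
  rw [h4, neg_one_smul] at h2
  refine ⟨by rw [h2, neg_neg], ?_⟩
  -- When N = -n, the second derivative of the height along v equals h(v, v): convexity makes it
  -- nonnegative and maximality nonpositive. Polarization then gives h = 0.
  have hzero : ∀ v, inner ℝ (fderiv ℝ N q v) (fderiv ℝ X q v) = 0 := by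
    intro v
    by_contra hne
    have hpos := lt_of_le_of_ne (h.convex q hq v) (Ne.symm hne)
    rw [h.inner_fderiv_normal_eq hq, ← inner_neg_left, ← h2] at hpos
    have hline : ∀ s : ℝ, HasDerivAt (fun s : ℝ => q + s • v) v s := fun s => by
      simpa using ((hasDerivAt_id s).smul_const v).const_add q
    have hcont : ContinuousAt (fun s : ℝ => q + s • v) 0 := (hline 0).continuousAt
    have hlim : Tendsto (fun s : ℝ => q + s • v) (𝓝 0) (𝓝 q) := by simpa using hcont.tendsto
    have hd1 : ∀ᶠ s : ℝ in 𝓝 0, HasDerivAt (fun s : ℝ => (inner ℝ (X (q + s • v)) n : ℝ))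
        (inner ℝ (fderiv ℝ X (q + s • v) v) n) s := by
      filter_upwards [hlim (h.isOpen.mem_nhds hq)] with s hs
      have h5 := (h.hasStrictFDerivAt hs).hasFDerivAt.comp_hasDerivAt s (hline s)
      simpa using h5.inner ℝ (hasDerivAt_const s n)
    have hd2 : HasDerivAt (fun s : ℝ => (inner ℝ (fderiv ℝ X (q + s • v) v) n : ℝ))
        (inner ℝ (fderiv ℝ (fderiv ℝ X) q v v) n) 0 := by
      have h5 : HasFDerivAt (fun z => fderiv ℝ X z v)
          (ContinuousLinearMap.apply ℝ E3 v ∘L fderiv ℝ (fderiv ℝ X) q) (q + (0 : ℝ) • v) := by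
        rw [zero_smul, add_zero]
        exact (ContinuousLinearMap.apply ℝ E3 v).hasFDerivAt.comp q
          (differentiableAt_fderiv (h.contDiffAt hq)).hasFDerivAt
      have h6 := (h5.comp_hasDerivAt (0 : ℝ) (hline 0)).inner ℝ (hasDerivAt_const (0 : ℝ) n)
      simpa using h6
    have h7 : IsLocalMax (fun s : ℝ => (inner ℝ (X (q + s • v)) n : ℝ)) 0 := by
      filter_upwards [hlim hmax] with s hs
      simpa using hs
    have h8 := second_deriv_nonpos_of_isLocalMax hd1 hd2 h7
    rw [real_inner_comm] at h8
    linarith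
  have h00 := hzero (EuclideanSpace.single 0 1)
  have h11 := hzero (EuclideanSpace.single 1 1)
  have h01 := hzero (EuclideanSpace.single 0 1 + EuclideanSpace.single 1 1)
  have hs := h.pairingMatrix_symm hq
  simp only [pairingMatrix, Matrix.of_apply] at hs
  simp only [map_add, inner_add_left, inner_add_right, h00, h11, hs] at h01
  rw [weingartenMatrix, Matrix.det_mul, Matrix.det_fin_two (pairingMatrix _ (fderiv ℝ N q))]
  simp only [pairingMatrix, Matrix.of_apply, h00, hs]
  have : inner ℝ (fderiv ℝ N q (EuclideanSpace.single 0 1))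
    (fderiv ℝ X q (EuclideanSpace.single 1 1)) = 0 := by linarith
  rw [this]; ring

/-- A connected totally umbilical patch has constant curvature and is a piece of a sphere or
plane. -/
lemma const_of_umbilic (h : IsConvexPatch X N W) (hW : IsPreconnected W) {c : E2 → ℝ}
    (hc : ∀ q ∈ W, fderiv ℝ N q = c q • fderiv ℝ X q) {q₁ q₂ : E2} (h₁ : q₁ ∈ W) (h₂ : q₂ ∈ W) :
    c q₁ = c q₂ ∧ N q₁ - c q₁ • X q₁ = N q₂ - c q₂ • X q₂ := by
  -- Regularity of `c` is not assumed; it follows by writing `c` as h₀₀/g₀₀.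
  have hdc : ∀ q ∈ W, DifferentiableAt ℝ c q := by
    intro q hq
    set e : E2 := EuclideanSpace.single 0 1
    have hne : ∀ z ∈ W, inner ℝ (fderiv ℝ X z e) (fderiv ℝ X z e) ≠ (0 : ℝ) := fun z hz =>
      (pairingMatrix_self_pos (h.injective z hz)).ne'
    have h1 : c =ᶠ[𝓝 q] fun z => inner ℝ (fderiv ℝ N z e) (fderiv ℝ X z e) /
        inner ℝ (fderiv ℝ X z e) (fderiv ℝ X z e) := by
      filter_upwards [h.isOpen.mem_nhds hq] with z hz
      rw [eq_div_iff (hne z hz), hc z hz]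
      simp [inner_smul_left]
    refine DifferentiableAt.congr_of_eventuallyEq ?_ h1
    have hX := (differentiableAt_fderiv (h.contDiffAt hq)).clm_apply (differentiableAt_const e)
    have hN := (differentiableAt_fderiv (h.contDiffAt_normal hq)).clm_apply
      (differentiableAt_const e)
    have h2 : DifferentiableAt ℝ
        (fun z => (inner ℝ (fderiv ℝ N z e) (fderiv ℝ X z e) : ℝ)) q := hN.inner ℝ hX
    have h3 : DifferentiableAt ℝ
        (fun z => (inner ℝ (fderiv ℝ X z e) (fderiv ℝ X z e) : ℝ)) q := hX.inner ℝ hX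
    simp only [div_eq_mul_inv]
    exact h2.mul (h3.fun_inv (hne q hq))
  have hdc0 : ∀ q ∈ W, fderiv ℝ c q = 0 := by
    intro q hq
    have h1 : fderiv ℝ N =ᶠ[𝓝 q] fun z => c z • fderiv ℝ X z := by
      filter_upwards [h.isOpen.mem_nhds hq] with z hz using hc z hz
    have h2 := h1.fderiv_eq (𝕜 := ℝ)
    rw [fderiv_fun_smul (hdc q hq) (differentiableAt_fderiv (h.contDiffAt hq))] at h2
    have h3 : ∀ v w, fderiv ℝ (fderiv ℝ N) q v w =
        c q • fderiv ℝ (fderiv ℝ X) q v w + fderiv ℝ c q v • fderiv ℝ X q w := fun v w => by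
      rw [h2]; simp
    -- The Codazzi argument: differentiating DN = c DX and using the symmetry of D²N and D²X leaves
    -- dc(v) w = dc(w) v, which for independent v, w forces dc = 0.
    have h4 : ∀ v w, fderiv ℝ c q v • w = fderiv ℝ c q w • v := fun v w => by
      apply h.injective q hq
      have h5 := h3 v w
      rw [fderiv_fderiv_symm (h.contDiffAt_normal hq), h3 w v,
        fderiv_fderiv_symm (h.contDiffAt hq) w v] at h5
      rw [map_smul, map_smul]
      exact (add_left_cancel h5).symm
    have h6 := h4 (EuclideanSpace.single 0 1) (EuclideanSpace.single 1 1)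
    have h7 := congrArg (fun v : E2 => v 0) h6
    have h8 := congrArg (fun v : E2 => v 1) h6
    simp at h7 h8
    ext v
    rw [E2_eq_sum v]
    simp [h8, ← h7]
  have hconst : ∀ q ∈ W, c q = c q₁ := fun q hq =>
    h.isOpen.is_const_of_fderiv_eq_zero hW
      (fun z hz => (hdc z hz).differentiableWithinAt) (fun z hz => hdc0 z hz) hq h₁
  refine ⟨(hconst _ h₂).symm, ?_⟩
  rw [hconst _ h₂]
  have hd : ∀ z ∈ W, HasFDerivAt (fun z => N z - c q₁ • X z) (0 : E2 →L[ℝ] E3) z := fun z hz => by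
    have := (h.hasStrictFDerivAt_normal hz).hasFDerivAt.sub
      ((h.hasStrictFDerivAt hz).hasFDerivAt.const_smul (c q₁))
    rwa [hc z hz, hconst z hz, sub_self] at this
  exact h.isOpen.is_const_of_fderiv_eq_zero hW (f := fun z => N z - c q₁ • X z)
      (fun z hz => (hd z hz).differentiableAt.differentiableWithinAt)
      (fun z hz => (hd z hz).fderiv) h₁ h₂

/-- The normal of a sphere is radial up to a sign, and the sign is locally constant by continuity.
Squaring the trace makes the sign irrelevant. -/
lemma trace_sq_of_sphere (h : IsConvexPatch X N W) (hq : q ∈ W) {c : E3} {r : ℝ} (hr : 0 < r)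
    (hs : ∀ z ∈ W, ‖X z - c‖ = r) :
    (weingartenMatrix (fderiv ℝ X q) (fderiv ℝ N q)).trace ^ 2 = 4 / r ^ 2 := by
  have h1 : ∀ z ∈ W, X z - c = (inner ℝ (N z) (X z - c) : ℝ) • N z := by
    intro z hz
    refine eq_of_inner_eq (h.norm_normal z hz) (h.orthogonal z hz) (h.injective z hz) fun v => ?_
    have hd : DifferentiableAt ℝ (fun z => X z - c) z :=
      (h.hasStrictFDerivAt hz).hasFDerivAt.differentiableAt.sub_const c
    have h2 : (fun z => (inner ℝ (X z - c) (X z - c) : ℝ)) =ᶠ[𝓝 z] fun _ => r ^ 2 := by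
      filter_upwards [h.isOpen.mem_nhds hz] with y hy
      rw [real_inner_self_eq_norm_sq, hs y hy]
    have h3 := congrArg (fun L : E2 →L[ℝ] ℝ => L v) h2.fderiv_eq
    simp only [fderiv_inner_apply ℝ hd hd, fderiv_fun_const, fderiv_sub_const] at h3
    rw [real_inner_comm (X z - c) (fderiv ℝ X z v)] at h3
    simp at h3
    linarith
  have h2 : ∀ z ∈ W, |inner ℝ (N z) (X z - c)| = r := by
    intro z hz
    have := congrArg norm (h1 z hz)
    rw [norm_smul, h.norm_normal z hz, hs z hz, mul_one, Real.norm_eq_abs] at this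
    exact this.symm
  set s : ℝ := inner ℝ (N q) (X q - c) with hsdef
  have hs2 : s ^ 2 = r ^ 2 := by rw [← sq_abs, h2 q hq]
  have hs0 : s ≠ 0 := by rintro h0; rw [h0] at hs2; nlinarith
  have hcont : ContinuousAt (fun z => (inner ℝ (N z) (X z - c) : ℝ) * s) q := by
    have h3 := (h.contDiffAt hq).continuousAt
    have h4 := (h.contDiffAt_normal hq).continuousAt
    exact (h4.inner (h3.sub continuousAt_const)).mul continuousAt_const
  have h3 : N =ᶠ[𝓝 q] fun z => s⁻¹ • (X z - c) := by
    have hpos : 0 < s * s := mul_self_pos.2 hs0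
    filter_upwards [h.isOpen.mem_nhds hq, hcont.eventually_const_lt hpos] with z hz hz2
    have h4 : inner ℝ (N z) (X z - c) = s := by
      have h5 : (inner ℝ (N z) (X z - c)) ^ 2 = s ^ 2 := by rw [hs2, ← sq_abs, h2 z hz]
      rcases sq_eq_sq_iff_eq_or_eq_neg.1 h5 with h6 | h6
      · exact h6
      · rw [h6] at hz2; nlinarith
    have h7 := h1 z hz
    rw [h4] at h7
    rw [h7, smul_smul, inv_mul_cancel₀ hs0, one_smul]
  have h4 : fderiv ℝ N q = s⁻¹ • fderiv ℝ X q := by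
    rw [h3.fderiv_eq, fderiv_fun_const_smul
      ((h.hasStrictFDerivAt hq).hasFDerivAt.differentiableAt.sub_const c), fderiv_sub_const]
  rw [h.trace_of_fderiv_normal_eq_smul hq h4, mul_pow, inv_pow, hs2]
  ring

end IsConvexPatch

/-! ### Surfaces in charts -/

section Charts

variable {M : Type*} [TopologicalSpace M] [ChartedSpace (EuclideanHalfSpace 2) M]

/-- The expression of `f` in the preferred chart at `p`. -/
def chartRep (f : M → E3) (p : M) : E2 → E3 := f ∘ (extChartAt (𝓡∂ 2) p).symm

/-- The derivative at `q` of the preferred chart at `p`. -/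
def chartDeriv (p q : M) : E2 →L[ℝ] E2 := mfderiv (𝓡∂ 2) 𝓘(ℝ, E2) (extChartAt (𝓡∂ 2) p) q

/-- The Gauss curvature, as the determinant of the Weingarten map. -/
def gaussCurvature (x ν : M → E3) (p : M) : ℝ :=
  (weingartenMatrix (differential x p) (differential ν p)).det

lemma meanCurvature_eq_trace (x ν : M → E3) (p : M) :
    meanCurvature x ν p = (weingartenMatrix (differential x p) (differential ν p)).trace := rfl

lemma chartRep_extChartAt (f : M → E3) {p q : M} (hq : q ∈ (extChartAt (𝓡∂ 2) p).source) :
    chartRep f p (extChartAt (𝓡∂ 2) p q) = f q := by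
  simp only [chartRep, Function.comp_apply, (extChartAt (𝓡∂ 2) p).left_inv hq]

variable {θ : ℝ} {x ν : M → E3}

lemma range_mem_nhds {p : M} {y : E2} (hy : y ∈ interior (extChartAt (𝓡∂ 2) p).target) :
    range (𝓡∂ 2) ∈ 𝓝 y :=
  mem_of_superset (mem_interior_iff_mem_nhds.1 hy) (extChartAt_target_subset_range p)

lemma IsCapillarySurface.mem_interior_iff_pos (hx : IsCapillarySurface θ x ν) {p : M} :
    p ∈ (𝓡∂ 2).interior M ↔ 0 < x p 2 := by
  refine ⟨hx.interior_pos p, fun h => ?_⟩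
  by_contra hp
  rw [← mem_compl_iff, ModelWithCorners.compl_interior] at hp
  exact h.ne' (hx.boundary_zero p hp)

lemma IsCapillarySurface.nonneg (hx : IsCapillarySurface θ x ν) (p : M) : 0 ≤ x p 2 := by
  by_cases hp : p ∈ (𝓡∂ 2).interior M
  · exact (hx.interior_pos p hp).le
  · rw [← mem_compl_iff, ModelWithCorners.compl_interior] at hp
    exact (hx.boundary_zero p hp).ge

variable [IsManifold (𝓡∂ 2) ∞ M]

instance : IsManifold (𝓡∂ 2) 1 M := IsManifold.of_le (n := ∞) (by norm_cast)

lemma contDiffOn_chartRep {f : M → E3} (hf : ContMDiff (𝓡∂ 2) 𝓘(ℝ, E3) ∞ f) (p : M) :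
    ContDiffOn ℝ ∞ (chartRep f p) (extChartAt (𝓡∂ 2) p).target := by
  rw [← contMDiffOn_iff_contDiffOn]
  exact hf.comp_contMDiffOn (contMDiffOn_extChartAt_symm p)

lemma contDiffWithinAt_chartRep {f : M → E3} (hf : ContMDiff (𝓡∂ 2) 𝓘(ℝ, E3) ∞ f) (p : M)
    {y : E2} (hy : y ∈ (extChartAt (𝓡∂ 2) p).target) :
    ContDiffWithinAt ℝ ∞ (chartRep f p) (range (𝓡∂ 2)) y :=
  ((contDiffOn_chartRep hf p) y hy).mono_of_mem_nhdsWithin (extChartAt_target_mem_nhdsWithin_of_mem hy)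

lemma det_chartDeriv_ne_zero {p q : M} (hq : q ∈ (extChartAt (𝓡∂ 2) p).source) :
    (chartDeriv p q).det ≠ 0 := by
  obtain ⟨e, he⟩ := isInvertible_mfderiv_extChartAt (I := 𝓡∂ 2) hq
  let e' : E2 ≃L[ℝ] E2 := e
  have h : chartDeriv p q = (e' : E2 →L[ℝ] E2) := he.symm
  rw [h]
  exact (LinearEquiv.isUnit_det' e'.toLinearEquiv).ne_zero

/-- The tangent space at q is read in the preferred chart at q, while `chartRep f p` uses the chart
at p; `chartDeriv p q` mediates. Derivatives within the half-plane keep the formula valid at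
boundary points. -/
lemma differential_eq_comp {f : M → E3} (hf : ContMDiff (𝓡∂ 2) 𝓘(ℝ, E3) ∞ f) {p q : M}
    (hq : q ∈ (extChartAt (𝓡∂ 2) p).source) :
    differential f q =
      fderivWithin ℝ (chartRep f p) (range (𝓡∂ 2)) (extChartAt (𝓡∂ 2) p q) ∘L chartDeriv p q := by
  have h1 : HasMFDerivWithinAt 𝓘(ℝ, E2) 𝓘(ℝ, E3) (chartRep f p) (range (𝓡∂ 2))
      (extChartAt (𝓡∂ 2) p q)
      (fderivWithin ℝ (chartRep f p) (range (𝓡∂ 2)) (extChartAt (𝓡∂ 2) p q)) :=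
    ((contDiffWithinAt_chartRep hf p ((extChartAt (𝓡∂ 2) p).map_source hq)).differentiableWithinAt
      (by simp)).hasFDerivWithinAt.hasMFDerivWithinAt
  have h2 : HasMFDerivWithinAt (𝓡∂ 2) 𝓘(ℝ, E2) (extChartAt (𝓡∂ 2) p) univ q (chartDeriv p q) :=
    (mdifferentiableAt_extChartAt (by rwa [← extChartAt_source (𝓡∂ 2)])).hasMFDerivAt.hasMFDerivWithinAt
  have h3 := h1.comp q h2 (fun z _ => by simp [extChartAt])
  rw [hasMFDerivWithinAt_univ] at h3
  have h4 : f =ᶠ[𝓝 q] chartRep f p ∘ extChartAt (𝓡∂ 2) p := by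
    filter_upwards [(isOpen_extChartAt_source (I := 𝓡∂ 2) p).mem_nhds hq] with z hz
    exact (chartRep_extChartAt f hz).symm
  exact (h3.congr_of_eventuallyEq h4).mfderiv

lemma mem_interior_iff {p q : M} (hq : q ∈ (extChartAt (𝓡∂ 2) p).source) :
    q ∈ (𝓡∂ 2).interior M ↔
      extChartAt (𝓡∂ 2) p q ∈ interior (extChartAt (𝓡∂ 2) p).target :=
  (𝓡∂ 2).isInteriorPoint_iff_of_mem_atlas (n := 1) one_ne_zero (chart_mem_atlas _ p)
    (by rwa [← extChartAt_source (𝓡∂ 2)])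

lemma differential_eq_comp_of_mem_interior {f : M → E3} (hf : ContMDiff (𝓡∂ 2) 𝓘(ℝ, E3) ∞ f)
    {p : M} {y : E2} (hy : y ∈ interior (extChartAt (𝓡∂ 2) p).target) :
    differential f ((extChartAt (𝓡∂ 2) p).symm y) =
      fderiv ℝ (chartRep f p) y ∘L chartDeriv p ((extChartAt (𝓡∂ 2) p).symm y) := by
  have h := differential_eq_comp hf ((extChartAt (𝓡∂ 2) p).map_target (interior_subset hy))
  rw [(extChartAt (𝓡∂ 2) p).right_inv (interior_subset hy),
    fderivWithin_of_mem_nhds (range_mem_nhds hy)] at h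
  exact h

lemma chartDeriv_surjective {p q : M} (hq : q ∈ (extChartAt (𝓡∂ 2) p).source) (v : E2) :
    ∃ w, chartDeriv p q w = v :=
  ((chartDeriv p q).toContinuousLinearEquivOfDetNeZero (det_chartDeriv_ne_zero hq)).surjective v

lemma IsConvexCapillarySurface.isConvexPatch (hx : IsConvexCapillarySurface θ x ν) (p : M) :
    IsConvexPatch (chartRep x p) (chartRep ν p) (interior (extChartAt (𝓡∂ 2) p).target) where
  isOpen := isOpen_interior
  smooth := (contDiffOn_chartRep hx.smooth p).mono interior_subset
  smooth_normal := (contDiffOn_chartRep hx.smooth_normal p).mono interior_subset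
  injective y hy := by
    set q := (extChartAt (𝓡∂ 2) p).symm y
    have hq : q ∈ (extChartAt (𝓡∂ 2) p).source :=
      (extChartAt (𝓡∂ 2) p).map_target (interior_subset hy)
    intro v₁ v₂ h
    obtain ⟨w₁, rfl⟩ := chartDeriv_surjective hq v₁
    obtain ⟨w₂, rfl⟩ := chartDeriv_surjective hq v₂
    have := hx.immersion q
    rw [differential_eq_comp_of_mem_interior hx.smooth hy] at this
    exact congrArg _ (this h)
  norm_normal y _ := hx.norm_normal _
  orthogonal y hy v := by
    obtain ⟨w, rfl⟩ := chartDeriv_surjective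
      ((extChartAt (𝓡∂ 2) p).map_target (interior_subset hy)) v
    have := hx.normal_orthogonal ((extChartAt (𝓡∂ 2) p).symm y) w
    rw [differential_eq_comp_of_mem_interior hx.smooth hy] at this
    exact this
  convex y hy v := by
    obtain ⟨w, rfl⟩ := chartDeriv_surjective
      ((extChartAt (𝓡∂ 2) p).map_target (interior_subset hy)) v
    have : 0 ≤ inner ℝ (differential ν ((extChartAt (𝓡∂ 2) p).symm y) w)
        (differential x ((extChartAt (𝓡∂ 2) p).symm y) w) :=
      hx.convex ((extChartAt (𝓡∂ 2) p).symm y) w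
    rw [differential_eq_comp_of_mem_interior hx.smooth hy,
      differential_eq_comp_of_mem_interior hx.smooth_normal hy] at this
    exact this

lemma IsConvexCapillarySurface.meanCurvature_symm (hx : IsConvexCapillarySurface θ x ν) {p : M}
    {y : E2} (hy : y ∈ interior (extChartAt (𝓡∂ 2) p).target) :
    meanCurvature x ν ((extChartAt (𝓡∂ 2) p).symm y) =
      (weingartenMatrix (fderiv ℝ (chartRep x p) y) (fderiv ℝ (chartRep ν p) y)).trace := by
  rw [meanCurvature_eq_trace, differential_eq_comp_of_mem_interior hx.smooth hy,
    differential_eq_comp_of_mem_interior hx.smooth_normal hy]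
  exact trace_weingartenMatrix_comp _ _ _
    (det_chartDeriv_ne_zero ((extChartAt (𝓡∂ 2) p).map_target (interior_subset hy)))

lemma IsConvexCapillarySurface.gaussCurvature_symm (hx : IsConvexCapillarySurface θ x ν) {p : M}
    {y : E2} (hy : y ∈ interior (extChartAt (𝓡∂ 2) p).target) :
    gaussCurvature x ν ((extChartAt (𝓡∂ 2) p).symm y) =
      (weingartenMatrix (fderiv ℝ (chartRep x p) y) (fderiv ℝ (chartRep ν p) y)).det := by
  rw [gaussCurvature, differential_eq_comp_of_mem_interior hx.smooth hy,
    differential_eq_comp_of_mem_interior hx.smooth_normal hy]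
  exact det_weingartenMatrix_comp _ _ _
    (det_chartDeriv_ne_zero ((extChartAt (𝓡∂ 2) p).map_target (interior_subset hy)))

/-! ### Continuity and sign of the curvatures -/

lemma continuousAt_weingartenMatrix {Z : Type*} [TopologicalSpace Z] {A B : Z → E2 →L[ℝ] E3} {z : Z}
    (hA : ContinuousAt A z) (hB : ContinuousAt B z)
    (h : (pairingMatrix (A z) (A z)).det ≠ 0) :
    ContinuousAt (fun z => weingartenMatrix (A z) (B z)) z := by
  have hp : ∀ {C : Z → E2 →L[ℝ] E3}, ContinuousAt C z →
      ContinuousAt (fun z => pairingMatrix (A z) (C z)) z := by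
    intro C hC
    refine continuousAt_pi.2 fun i => continuousAt_pi.2 fun j => ?_
    exact (hC.clm_apply continuousAt_const).inner (hA.clm_apply continuousAt_const)
  have hinv : ContinuousAt (fun z => (pairingMatrix (A z) (A z))⁻¹) z := by
    simp only [Matrix.inv_def, Ring.inverse_eq_inv']
    have h1 : Continuous fun m : Matrix (Fin 2) (Fin 2) ℝ => m.det := continuous_id.matrix_det
    have h2 : Continuous fun m : Matrix (Fin 2) (Fin 2) ℝ => m.adjugate :=
      continuous_id.matrix_adjugate
    have h3 : ContinuousAt (fun z => (pairingMatrix (A z) (A z)).det) z :=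
      h1.continuousAt.comp (hp hA)
    have h4 : ContinuousAt (fun z => (pairingMatrix (A z) (A z)).adjugate) z :=
      h2.continuousAt.comp (hp hA)
    exact (h3.inv₀ h).smul h4
  have hm : Continuous fun m : Matrix (Fin 2) (Fin 2) ℝ × Matrix (Fin 2) (Fin 2) ℝ => m.1 * m.2 :=
    continuous_fst.matrix_mul continuous_snd
  exact hm.continuousAt.comp (hinv.prodMk (hp hB))

lemma continuousAt_fderivWithin_chartRep {f : M → E3} (hf : ContMDiff (𝓡∂ 2) 𝓘(ℝ, E3) ∞ f) (p : M) :
    ContinuousAt (fun q => fderivWithin ℝ (chartRep f p) (range (𝓡∂ 2)) (extChartAt (𝓡∂ 2) p q))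
      p := by
  have h1 : ContinuousWithinAt (fderivWithin ℝ (chartRep f p) (range (𝓡∂ 2))) (range (𝓡∂ 2))
      (extChartAt (𝓡∂ 2) p p) :=
    ((contDiffWithinAt_chartRep hf p (mem_extChartAt_target p)).fderivWithin_right (m := 0)
      (𝓡∂ 2).uniqueDiffOn (by norm_cast)
      (extChartAt_target_subset_range p (mem_extChartAt_target p))).continuousWithinAt
  have h2 : ContinuousAt (extChartAt (𝓡∂ 2) p) p := continuousAt_extChartAt p
  have h3 := ContinuousWithinAt.comp (t := range (𝓡∂ 2)) (s := univ) (x := p) h1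
    h2.continuousWithinAt (fun z _ => by simp [extChartAt])
  exact continuousWithinAt_univ _ _ |>.1 h3

lemma IsConvexCapillarySurface.det_pairingMatrix_ne_zero (hx : IsConvexCapillarySurface θ x ν)
    (p : M) : (pairingMatrix (fderivWithin ℝ (chartRep x p) (range (𝓡∂ 2)) (extChartAt (𝓡∂ 2) p p))
      (fderivWithin ℝ (chartRep x p) (range (𝓡∂ 2)) (extChartAt (𝓡∂ 2) p p))).det ≠ 0 := by
  have h := det_pairingMatrix_pos (A := differential x p) (hx.norm_normal p)
    (hx.normal_orthogonal p) (hx.immersion p)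
  intro h0
  rw [differential_eq_comp hx.smooth (mem_extChartAt_source (I := 𝓡∂ 2) p)] at h
  have h2 := pairingMatrix_comp (fderivWithin ℝ (chartRep x p) (range (𝓡∂ 2)) (extChartAt (𝓡∂ 2) p p))
    (fderivWithin ℝ (chartRep x p) (range (𝓡∂ 2)) (extChartAt (𝓡∂ 2) p p)) (chartDeriv p p)
  have h3 := congrArg Matrix.det h2
  rw [Matrix.det_mul, Matrix.det_mul, h0] at h3
  simp only [mul_zero, zero_mul] at h3
  exact h.ne' h3

/-- The definition changes chart with the point; invariance of the trace allows one fixed chart near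
each point. -/
lemma IsConvexCapillarySurface.continuous_meanCurvature (hx : IsConvexCapillarySurface θ x ν) :
    Continuous (meanCurvature x ν) := by
  rw [continuous_iff_continuousAt]
  intro p
  have h1 := continuousAt_weingartenMatrix (continuousAt_fderivWithin_chartRep hx.smooth p)
    (continuousAt_fderivWithin_chartRep hx.smooth_normal p) (hx.det_pairingMatrix_ne_zero p)
  have h2 : Continuous fun m : Matrix (Fin 2) (Fin 2) ℝ => m.trace := continuous_id.matrix_trace
  refine (h2.continuousAt.comp h1).congr ?_
  filter_upwards [extChartAt_source_mem_nhds (I := 𝓡∂ 2) p] with q hq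
  rw [meanCurvature_eq_trace, differential_eq_comp hx.smooth hq,
    differential_eq_comp hx.smooth_normal hq]
  exact (trace_weingartenMatrix_comp _ _ _ (det_chartDeriv_ne_zero hq)).symm

lemma IsConvexCapillarySurface.continuous_gaussCurvature (hx : IsConvexCapillarySurface θ x ν) :
    Continuous (gaussCurvature x ν) := by
  rw [continuous_iff_continuousAt]
  intro p
  have h1 := continuousAt_weingartenMatrix (continuousAt_fderivWithin_chartRep hx.smooth p)
    (continuousAt_fderivWithin_chartRep hx.smooth_normal p) (hx.det_pairingMatrix_ne_zero p)
  have h2 : Continuous fun m : Matrix (Fin 2) (Fin 2) ℝ => m.det := continuous_id.matrix_det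
  refine (h2.continuousAt.comp h1).congr ?_
  filter_upwards [extChartAt_source_mem_nhds (I := 𝓡∂ 2) p] with q hq
  rw [gaussCurvature, differential_eq_comp hx.smooth hq,
    differential_eq_comp hx.smooth_normal hq]
  exact (det_weingartenMatrix_comp _ _ _ (det_chartDeriv_ne_zero hq)).symm

lemma extChartAt_mem_interior {p : M} (hp : p ∈ (𝓡∂ 2).interior M) :
    extChartAt (𝓡∂ 2) p p ∈ interior (extChartAt (𝓡∂ 2) p).target :=
  (mem_interior_iff (mem_extChartAt_source p)).1 hp

lemma IsConvexCapillarySurface.four_gaussCurvature_le (hx : IsConvexCapillarySurface θ x ν) {p : M}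
    (hp : p ∈ (𝓡∂ 2).interior M) : 4 * gaussCurvature x ν p ≤ meanCurvature x ν p ^ 2 := by
  have h := (hx.isConvexPatch p).four_det_le (extChartAt_mem_interior hp)
  rwa [← hx.meanCurvature_symm (extChartAt_mem_interior hp),
    ← hx.gaussCurvature_symm (extChartAt_mem_interior hp), extChartAt_to_inv] at h

lemma IsConvexCapillarySurface.gaussCurvature_nonneg (hx : IsConvexCapillarySurface θ x ν) {p : M}
    (hp : p ∈ (𝓡∂ 2).interior M) : 0 ≤ gaussCurvature x ν p := by
  have h := (hx.isConvexPatch p).det_nonneg (extChartAt_mem_interior hp)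
  rwa [← hx.gaussCurvature_symm (extChartAt_mem_interior hp), extChartAt_to_inv] at h

end Charts

section Covering

variable {M : Type*} [TopologicalSpace M] [ChartedSpace (EuclideanHalfSpace 2) M]
  {θ : ℝ} {x ν : M → E3}

/-! ### Maxima of height functions -/

/-- First-order condition at a boundary maximum: the vectors with v₀ ≥ 0 lie in the tangent cone of
the half-plane. `D` is the differential retyped as a map on `E2`. -/
lemma inner_differential_nonpos [IsManifold (𝓡∂ 2) ∞ M] {f : M → E3} (hf : ContMDiff (𝓡∂ 2) 𝓘(ℝ, E3) ∞ f) {p : M}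
    (hp : p ∈ (𝓡∂ 2).boundary M) {n : E3}
    (hmax : ∀ᶠ q in 𝓝 p, (inner ℝ (f q) n : ℝ) ≤ inner ℝ (f p) n) {D : E2 →L[ℝ] E3}
    (hD : D = differential f p) (v : E2) (hv : 0 ≤ v 0) : inner ℝ (D v) n ≤ 0 := by
  set q₀ := extChartAt (𝓡∂ 2) p p with hq₀
  have hq₀0 : q₀ 0 = 0 := by
    have h := ModelWithCorners.isBoundaryPoint_iff.1 hp
    rw [frontier_range_modelWithCornersEuclideanHalfSpace] at h
    exact h.symm
  have hd : HasFDerivWithinAt (chartRep f p) D (range (𝓡∂ 2)) q₀ := by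
    rw [hD]
    exact ((hf p).mdifferentiableAt (by simp)).hasMFDerivAt.2
  have hd2 := hd.inner ℝ (hasFDerivWithinAt_const n q₀ (range (𝓡∂ 2)))
  have hmax2 : IsLocalMaxOn (fun y => (inner ℝ (chartRep f p y) n : ℝ)) (range (𝓡∂ 2)) q₀ := by
    have h1 := map_extChartAt_symm_nhdsWithin_range (I := 𝓡∂ 2) p
    rw [← h1, eventually_map] at hmax
    filter_upwards [hmax] with y hy
    simpa only [chartRep, hq₀, Function.comp_apply, extChartAt_to_inv] using hy
  have hmem : v ∈ posTangentConeAt (range (𝓡∂ 2)) q₀ := by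
    apply mem_posTangentConeAt_of_segment_subset
    have hr : range (𝓡∂ 2) = {y : E2 | 0 ≤ y 0} := range_modelWithCornersEuclideanHalfSpace 2
    rw [hr]
    rintro y ⟨a, b, ha, hb, hab, rfl⟩
    have : (a • q₀ + b • (q₀ + v)) 0 = a * q₀ 0 + b * (q₀ 0 + v 0) := rfl
    rw [mem_ofPred_eq, this, hq₀0]
    have := mul_nonneg hb hv
    linarith
  have h := hmax2.hasFDerivWithinAt_nonpos hd2 hmem
  have h' : inner ℝ (chartRep f p q₀) (0 : E3) + inner ℝ (D v) n ≤ 0 := h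
  rwa [inner_zero_right, zero_add] at h'

/-- Here t is tangent to the boundary curve, w points into the surface and v is the surface normal.
Both n and v lie in the vertical plane orthogonal to t, with horizontal coefficients β and s. As 0 ≤
v₂ < n₂ (the place of θ ≤ π/2), |β| < |s|, and s²⟨n, w⟩ = w₂(n₂s² - βs v₂) is positive. -/
lemma height_pos_of_boundary_frame {t₀ t₁ n₀ n₁ n₂ v₀ v₁ v₂ w₀ w₁ w₂ : ℝ} (ht : 0 < t₀ ^ 2 + t₁ ^ 2)
    (hnt : n₀ * t₀ + n₁ * t₁ = 0) (hvt : v₀ * t₀ + v₁ * t₁ = 0)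
    (hn : n₀ ^ 2 + n₁ ^ 2 + n₂ ^ 2 = 1) (hv : v₀ ^ 2 + v₁ ^ 2 + v₂ ^ 2 = 1)
    (hv0 : 0 ≤ v₂) (hv1 : v₂ < 1) (hvn : v₂ < n₂) (hw : 0 < w₂)
    (hvw : v₀ * w₀ + v₁ * w₁ + v₂ * w₂ = 0) : 0 < n₀ * w₀ + n₁ * w₁ + n₂ * w₂ := by
  set T := t₀ ^ 2 + t₁ ^ 2 with hT
  have hrep : ∀ a b : ℝ, a * t₀ + b * t₁ = 0 →
      ∃ s, a = -s * t₁ ∧ b = s * t₀ := by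
    intro a b h
    refine ⟨(b * t₀ - a * t₁) / T, ?_, ?_⟩ <;> field_simp <;> rw [hT]
    · linear_combination t₀ * h
    · linear_combination t₁ * h
  obtain ⟨β, rfl, rfl⟩ := hrep _ _ hnt
  obtain ⟨s, rfl, rfl⟩ := hrep _ _ hvt
  have hs : s ^ 2 * T = 1 - v₂ ^ 2 := by rw [hT]; linarith
  have hβ : β ^ 2 * T = 1 - n₂ ^ 2 := by rw [hT]; linarith
  have hs0 : 0 < s ^ 2 := by
    have : 0 < s ^ 2 * T := by rw [hs]; nlinarith
    exact pos_of_mul_pos_left this ht.le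
  have hβs : β ^ 2 < s ^ 2 := by
    have : β ^ 2 * T < s ^ 2 * T := by rw [hs, hβ]; nlinarith
    exact lt_of_mul_lt_mul_right this ht.le
  have habs : |β| ≤ |s| := (sq_lt_sq.1 hβs).le
  have h1 : β * s ≤ s ^ 2 := by
    calc β * s ≤ |β * s| := le_abs_self _
      _ = |β| * |s| := abs_mul _ _
      _ ≤ |s| * |s| := by gcongr
      _ = s ^ 2 := by rw [abs_mul_abs_self, sq]
  have h2 : s ^ 2 * (-β * t₁ * w₀ + β * t₀ * w₁ + n₂ * w₂) = w₂ * (n₂ * s ^ 2 - β * s * v₂) := by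
    linear_combination (β * s) * hvw
  have h3 : 0 < w₂ * (n₂ * s ^ 2 - β * s * v₂) := by
    apply mul_pos hw
    have : β * s * v₂ ≤ s ^ 2 * v₂ := by gcongr
    nlinarith
  rw [← h2] at h3
  exact pos_of_mul_pos_right h3 hs0.le

lemma inner_eq_sum (u w : E3) : (inner ℝ u w : ℝ) = u 0 * w 0 + u 1 * w 1 + u 2 * w 2 := by
  simp [PiLp.inner_apply, Fin.sum_univ_three, mul_comm]

lemma inner_e3 (u : E3) : (inner ℝ u e3 : ℝ) = u 2 := by
  simp [inner_eq_sum, e3]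

lemma norm_e3 : ‖e3‖ = 1 := by simp [e3]

lemma IsCapillarySurface.normal_boundary (hx : IsCapillarySurface θ x ν) {p : M}
    (hp : p ∈ (𝓡∂ 2).boundary M) : ν p 2 = Real.cos θ := by
  have := hx.contact_angle p hp
  rw [inner_neg_right, inner_e3, Real.cos_pi_sub] at this
  linarith

variable [IsManifold (𝓡∂ 2) ∞ M]

lemma IsCapillarySurface.not_isMax_boundary (hx : IsCapillarySurface θ x ν) (hθ_pos : 0 < θ)
    (hθ_le : θ ≤ Real.pi / 2) {p : M} (hp : p ∈ (𝓡∂ 2).boundary M) {n : E3} (hn : ‖n‖ = 1)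
    (hnθ : Real.cos θ < n 2) : ¬ ∀ᶠ q in 𝓝 p, (inner ℝ (x q) n : ℝ) ≤ inner ℝ (x p) n := by
  intro hmax
  have hc0 : 0 ≤ Real.cos θ := Real.cos_nonneg_of_neg_pi_div_two_le_of_le (by linarith) hθ_le
  have hc1 : Real.cos θ < 1 := by
    rw [← Real.cos_zero]
    exact Real.cos_lt_cos_of_nonneg_of_le_pi_div_two le_rfl hθ_le hθ_pos
  have hν2 := hx.normal_boundary hp
  obtain ⟨D, hD⟩ : ∃ D : E2 →L[ℝ] E3, D = differential x p := ⟨_, rfl⟩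
  have h1' := inner_differential_nonpos hx.smooth hp hmax hD
  -- The boundary also minimizes the third coordinate; this makes t horizontal and w₂ ≥ 0.
  have h2 := inner_differential_nonpos hx.smooth hp (n := -e3) (by
    filter_upwards with q
    rw [inner_neg_right, inner_neg_right, inner_e3, inner_e3, hx.boundary_zero p hp, neg_zero]
    linarith [hx.nonneg q]) hD
  have h2' : ∀ v : E2, 0 ≤ v 0 → 0 ≤ D v 2 := fun v hv => by
    have := h2 v hv
    rw [inner_neg_right, inner_e3] at this
    linarith
  have horth : ∀ v : E2, inner ℝ (ν p) (D v) = 0 := by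
    rw [hD]; exact hx.normal_orthogonal p
  have hinj : Function.Injective D := by
    rw [hD]; exact hx.immersion p
  set t : E3 := D (EuclideanSpace.single 1 1) with ht
  set w : E3 := D (EuclideanSpace.single 0 1) with hw
  have ht2 : t 2 = 0 := by
    have h3 := h2' (EuclideanSpace.single 1 1) (by simp)
    have h4 := h2' (-EuclideanSpace.single 1 1) (by simp)
    rw [map_neg] at h4
    have h5 : (-t) 2 = - t 2 := rfl
    rw [← ht, h5] at h4
    exact le_antisymm (by linarith) h3
  have htn : inner ℝ t n = 0 := by
    have h3 := h1' (EuclideanSpace.single 1 1) (by simp)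
    have h4 := h1' (-EuclideanSpace.single 1 1) (by simp)
    rw [map_neg, inner_neg_left] at h4
    exact le_antisymm h3 (by linarith)
  have hwn : inner ℝ w n ≤ 0 := h1' _ (by simp)
  have hw0 : 0 ≤ w 2 := h2' _ (by simp)
  -- If w₂ = 0 the tangent plane is horizontal, so e₃ = cos θ · ν, impossible for unit vectors since
  -- cos θ < 1.
  have hw2 : 0 < w 2 := by
    refine lt_of_le_of_ne hw0 fun h0 => ?_
    have h3 : ∀ v, inner ℝ e3 (D v) = 0 := by
      intro v
      rw [real_inner_comm, inner_e3, E2_eq_sum v, map_add, map_smul, map_smul, ← ht, ← hw]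
      have : (v 0 • w + v 1 • t) 2 = v 0 * w 2 + v 1 * t 2 := rfl
      rw [this, ← h0, ht2]; ring
    have h4 := eq_of_inner_eq (hx.norm_normal p) horth hinj h3
    rw [inner_e3, hν2] at h4
    have h5 := congrArg norm h4
    rw [norm_smul, norm_e3, hx.norm_normal, Real.norm_eq_abs, abs_of_nonneg hc0] at h5
    linarith
  have htne : t ≠ 0 := fun h => by
    have := hinj (ht.symm.trans (h.trans (map_zero D).symm))
    have := congrArg (fun v : E2 => v 1) this
    simp at this
  have htT : 0 < t 0 ^ 2 + t 1 ^ 2 := by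
    have h3 : inner ℝ t t = t 0 ^ 2 + t 1 ^ 2 := by rw [inner_eq_sum, ht2]; ring
    rw [← h3, real_inner_self_eq_norm_sq]
    positivity
  have hsq : ∀ u : E3, ‖u‖ = 1 → u 0 ^ 2 + u 1 ^ 2 + u 2 ^ 2 = 1 := fun u hu => by
    have := real_inner_self_eq_norm_sq u
    rw [inner_eq_sum, hu] at this
    linarith
  have hνt := horth (EuclideanSpace.single 1 1)
  have hνw := horth (EuclideanSpace.single 0 1)
  rw [← ht, inner_eq_sum, ht2] at hνt
  rw [← hw, inner_eq_sum] at hνw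
  rw [inner_eq_sum, ht2] at htn
  rw [inner_eq_sum] at hwn
  have := height_pos_of_boundary_frame htT (by linarith) (by linarith) (hsq n hn)
    (hsq _ (hx.norm_normal p)) (hν2 ▸ hc0) (hν2 ▸ hc1) (hν2 ▸ hnθ) hw2 hνw
  linarith

lemma IsConvexCapillarySurface.normal_eq_or_of_isMax (hx : IsConvexCapillarySurface θ x ν) {p : M}
    (hp : p ∈ (𝓡∂ 2).interior M) {n : E3} (hn : ‖n‖ = 1)
    (hmax : ∀ᶠ q in 𝓝 p, (inner ℝ (x q) n : ℝ) ≤ inner ℝ (x p) n) :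
    ν p = n ∨ (ν p = -n ∧ gaussCurvature x ν p = 0) := by
  have hq := extChartAt_mem_interior hp
  have h := (hx.isConvexPatch p).normal_eq_or_of_isLocalMax hq hn (by
    have h1 := map_extChartAt_symm_nhdsWithin_range (I := 𝓡∂ 2) p
    rw [nhdsWithin_eq_nhds.2 (range_mem_nhds hq)] at h1
    rw [← h1, eventually_map] at hmax
    filter_upwards [hmax] with y hy
    simpa only [chartRep, Function.comp_apply, extChartAt_to_inv] using hy)
  rwa [← hx.gaussCurvature_symm hq, extChartAt_to_inv, chartRep_extChartAt _
    (mem_extChartAt_source p)] at h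

/-- Every direction of the open model cap is, up to sign, a normal of each clopen part of the
surface. -/
lemma IsConvexCapillarySurface.exists_normal_eq [CompactSpace M]
    (hx : IsConvexCapillarySurface θ x ν) (hθ_pos : 0 < θ) (hθ_le : θ ≤ Real.pi / 2) {C : Set M}
    (hC : IsClopen C) (hne : C.Nonempty) {n : E3} (hn : ‖n‖ = 1) (hnθ : Real.cos θ < n 2) :
    ∃ p ∈ C, p ∈ (𝓡∂ 2).interior M ∧ (ν p = n ∨ (ν p = -n ∧ gaussCurvature x ν p = 0)) := by
  have hcont : Continuous fun q => (inner ℝ (x q) n : ℝ) := by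
    have := hx.smooth.continuous
    fun_prop
  obtain ⟨p, hpC, hp⟩ := hC.isClosed.isCompact.exists_isMaxOn hne hcont.continuousOn
  have hmax : ∀ᶠ q in 𝓝 p, (inner ℝ (x q) n : ℝ) ≤ inner ℝ (x p) n := by
    filter_upwards [hC.isOpen.mem_nhds hpC] with q hq using hp hq
  have hint : p ∈ (𝓡∂ 2).interior M := by
    by_contra h
    rw [← mem_compl_iff, ModelWithCorners.compl_interior] at h
    exact hx.not_isMax_boundary hθ_pos hθ_le h hn hnθ hmax
  exact ⟨p, hpC, hint, hx.normal_eq_or_of_isMax hint hn hmax⟩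

end Covering

section Area

variable {M : Type*} [TopologicalSpace M] [ChartedSpace (EuclideanHalfSpace 2) M]
  {θ : ℝ} {x ν : M → E3}

/-! ### The area measure and the Gauss map -/

lemma IsCapillarySurface.measurableEmbedding [CompactSpace M] [MeasurableSpace M] [BorelSpace M]
    (hx : IsCapillarySurface θ x ν) : MeasurableEmbedding x :=
  (hx.smooth.continuous.isClosedEmbedding hx.embedding.injective).measurableEmbedding

lemma IsCapillarySurface.areaMeasure_apply [CompactSpace M] [MeasurableSpace M] [BorelSpace M]
    (hx : IsCapillarySurface θ x ν) (s : Set M) :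
    areaMeasure x s = (μHE[2] : Measure E3) (x '' s) :=
  hx.measurableEmbedding.comap_apply _ _

variable [IsManifold (𝓡∂ 2) ∞ M]

lemma IsCapillarySurface.exists_nhds_measure_image_lt_top (hx : IsCapillarySurface θ x ν) (p : M) :
    ∃ V ∈ 𝓝 p, (μHE[2] : Measure E3) (x '' V) < ⊤ := by
  have hconv : Convex ℝ (range (𝓡∂ 2)) := (𝓡∂ 2).convex_range
  obtain ⟨K, t, ht, hK⟩ := ((contDiffWithinAt_chartRep hx.smooth p
    (mem_extChartAt_target p)).of_le (m := 1) (by norm_cast)).exists_lipschitzOnWith hconv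
  set B := Metric.ball (extChartAt (𝓡∂ 2) p p) 1
  have hB : t ∩ B ∈ 𝓝[range (𝓡∂ 2)] (extChartAt (𝓡∂ 2) p p) :=
    inter_mem ht (mem_nhdsWithin_of_mem_nhds (Metric.ball_mem_nhds _ one_pos))
  have hV : extChartAt (𝓡∂ 2) p ⁻¹' (t ∩ B) ∈ 𝓝 p := by
    have := map_extChartAt_nhds (I := 𝓡∂ 2) p
    rw [← this] at hB
    exact hB
  refine ⟨_, inter_mem hV (extChartAt_source_mem_nhds (I := 𝓡∂ 2) p), ?_⟩
  have hsub : x '' (extChartAt (𝓡∂ 2) p ⁻¹' (t ∩ B) ∩ (extChartAt (𝓡∂ 2) p).source) ⊆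
      chartRep x p '' (t ∩ B) := by
    rintro _ ⟨q, ⟨hq1, hq2⟩, rfl⟩
    exact ⟨_, hq1, chartRep_extChartAt x hq2⟩
  refine (measure_mono hsub).trans_lt ((euclideanHausdorffMeasure_image_le_of_lipschitzOn
    (hK.mono inter_subset_left)).trans_lt ?_)
  rw [EuclideanSpace.euclideanHausdorffMeasure_eq_volume]
  exact ENNReal.mul_lt_top (ENNReal.pow_lt_top ENNReal.coe_lt_top)
    ((measure_mono inter_subset_right).trans_lt Metric.isBounded_ball.measure_lt_top)

lemma IsCapillarySurface.isFiniteMeasure_areaMeasure [CompactSpace M] [MeasurableSpace M]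
    [BorelSpace M] (hx : IsCapillarySurface θ x ν) : IsFiniteMeasure (areaMeasure x) := by
  refine ⟨isCompact_univ.measure_lt_top_of_nhdsWithin fun p _ => ?_⟩
  obtain ⟨V, hV, hlt⟩ := hx.exists_nhds_measure_image_lt_top p
  exact ⟨V, by simpa using hV, by rwa [hx.areaMeasure_apply]⟩

lemma symm_mem_nhds {p : M} (hp : p ∈ (𝓡∂ 2).interior M) {V : Set M} (hV : V ∈ 𝓝 p) :
    (extChartAt (𝓡∂ 2) p).symm ⁻¹' V ∈ 𝓝 (extChartAt (𝓡∂ 2) p p) := by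
  have h1 := map_extChartAt_symm_nhdsWithin_range (I := 𝓡∂ 2) p
  rw [nhdsWithin_eq_nhds.2 (range_mem_nhds (extChartAt_mem_interior hp))] at h1
  rw [← h1] at hV
  exact hV

lemma IsConvexCapillarySurface.measure_image_pos (hx : IsConvexCapillarySurface θ x ν) {p : M}
    (hp : p ∈ (𝓡∂ 2).interior M) {V : Set M} (hV : V ∈ 𝓝 p) :
    0 < (μHE[2] : Measure E3) (x '' V) := by
  have hq := extChartAt_mem_interior hp
  have hP := hx.isConvexPatch p
  refine (exists_nhds_measure_image_pos (hP.hasStrictFDerivAt hq) (hP.norm_normal _ hq)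
    (hP.orthogonal _ hq) (hP.injective _ hq) (symm_mem_nhds hp hV)).trans_le (measure_mono ?_)
  rintro _ ⟨y, hy, rfl⟩
  exact ⟨_, hy, rfl⟩

lemma IsConvexCapillarySurface.exists_nhds_measure_normal_image_le
    (hx : IsConvexCapillarySurface θ x ν) {p : M} (hp : p ∈ (𝓡∂ 2).interior M) {t : ℝ≥0}
    (ht : gaussCurvature x ν p < t) :
    ∃ V ∈ 𝓝 p, ∀ s ⊆ V, (μHE[2] : Measure E3) (ν '' s) ≤ t * (μHE[2] : Measure E3) (x '' s) := by
  have hq := extChartAt_mem_interior hp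
  have hP := hx.isConvexPatch p
  rw [← extChartAt_to_inv (I := 𝓡∂ 2) p, hx.gaussCurvature_symm hq,
    ← abs_of_nonneg (hP.det_nonneg hq)] at ht
  obtain ⟨V, hV, h⟩ := exists_nhds_measure_image_le (hP.hasStrictFDerivAt hq)
    (hP.hasStrictFDerivAt_normal hq)
    (by filter_upwards [hP.isOpen.mem_nhds hq] with z hz using hP.norm_normal z hz)
    (hP.orthogonal _ hq) (hP.injective _ hq) ht
  refine ⟨_, inter_mem (continuousAt_extChartAt (I := 𝓡∂ 2) p hV)
    (extChartAt_source_mem_nhds (I := 𝓡∂ 2) p), fun s hs => ?_⟩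
  have himg : ∀ f : M → E3, f '' s = chartRep f p '' (extChartAt (𝓡∂ 2) p '' s) := fun f => by
    rw [← image_comp]
    exact image_congr fun z hz => (chartRep_extChartAt f (hs hz).2).symm
  rw [himg, himg x]
  refine h _ ?_
  rintro _ ⟨z, hz, rfl⟩
  exact (hs hz).1

variable [CompactSpace M] [MeasurableSpace M] [BorelSpace M]

/-- The area of the Gauss image is at most the integral of the Gauss curvature. -/
lemma IsConvexCapillarySurface.measure_normal_image_le (hx : IsConvexCapillarySurface θ x ν)
    {s : Set M} (hs : MeasurableSet s) (hsi : s ⊆ (𝓡∂ 2).interior M) :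
    (μHE[2] : Measure E3) (ν '' s) ≤
      ∫⁻ p in s, ENNReal.ofReal (gaussCurvature x ν p) ∂(areaMeasure x) := by
  have := hx.isFiniteMeasure_areaMeasure
  have : SecondCountableTopology M := hx.embedding.secondCountableTopology
  have hmeas : Measurable fun p => ENNReal.ofReal (gaussCurvature x ν p) :=
    hx.continuous_gaussCurvature.measurable.ennreal_ofReal
  -- Near p the local comparison holds with constant K(p) + ε/2, and continuity gives K > K(p) -
  -- ε/2, so the integrand K + ε dominates. A countable cover made disjoint sums the local bounds,
  -- with total error ε times the area.
  have key : ∀ ε : ℝ≥0, 0 < ε → (μHE[2] : Measure E3) (ν '' s) ≤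
      (∫⁻ p in s, ENNReal.ofReal (gaussCurvature x ν p) ∂(areaMeasure x)) +
        ε * areaMeasure x univ := by
    intro ε hε
    have hloc : ∀ p : M, ∃ V : Set M, IsOpen V ∧ p ∈ V ∧ (p ∈ s → ∀ A ⊆ V ∩ s, MeasurableSet A →
        (μHE[2] : Measure E3) (ν '' A) ≤
          ∫⁻ q in A, (ENNReal.ofReal (gaussCurvature x ν q) + ε) ∂(areaMeasure x)) := by
      intro p
      by_cases hps : p ∈ s
      swap
      · exact ⟨univ, isOpen_univ, mem_univ _, fun h => absurd h hps⟩
      have h0 := hx.gaussCurvature_nonneg (hsi hps)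
      set t : ℝ≥0 := (gaussCurvature x ν p).toNNReal + ε / 2 with ht
      have htc : (t : ℝ) = gaussCurvature x ν p + ε / 2 := by
        rw [ht, NNReal.coe_add, Real.coe_toNNReal _ h0]; simp
      obtain ⟨V, hV, h⟩ := hx.exists_nhds_measure_normal_image_le (hsi hps) (t := t)
        (by rw [htc]; have : (0 : ℝ) < ε := hε; linarith)
      have hV2 : {q | gaussCurvature x ν p - ε / 2 < gaussCurvature x ν q} ∈ 𝓝 p :=
        hx.continuous_gaussCurvature.continuousAt.eventually_const_lt
          (by have : (0 : ℝ) < ε := hε; linarith)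
      obtain ⟨U, hUV, hU, hpU⟩ := mem_nhds_iff.1 (inter_mem hV hV2)
      refine ⟨U, hU, hpU, fun _ A hA hAm => ?_⟩
      refine (h A fun q hq => (hUV (hA hq).1).1).trans ?_
      rw [← hx.areaMeasure_apply, ← setLIntegral_const]
      refine setLIntegral_mono (hmeas.add_const _) fun q hq => ?_
      have h1 : gaussCurvature x ν p - ε / 2 < gaussCurvature x ν q := (hUV (hA hq).1).2
      have h2 : (ε : ℝ≥0∞) = ENNReal.ofReal ε := by simp
      have h3 : (t : ℝ≥0∞) = ENNReal.ofReal t := by simp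
      rw [h2, ← ENNReal.ofReal_add (hx.gaussCurvature_nonneg (hsi (hA hq).2)) ε.coe_nonneg, h3]
      apply ENNReal.ofReal_le_ofReal
      rw [htc]
      linarith
    choose V hVo hVm hV using hloc
    obtain ⟨T, hTs, hTc, hT⟩ := TopologicalSpace.countable_cover_nhdsWithin (s := s) (f := V)
      fun p _ => mem_nhdsWithin_of_mem_nhds ((hVo p).mem_nhds (hVm p))
    rcases s.eq_empty_or_nonempty with rfl | hsne
    · simp
    have hTne : T.Nonempty := by
      obtain ⟨p, hp⟩ := hsne
      obtain ⟨i, hi, _⟩ := mem_iUnion₂.1 (hT hp)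
      exact ⟨i, hi⟩
    obtain ⟨f, rfl⟩ := hTc.exists_eq_range hTne
    set D : ℕ → Set M := fun n => s ∩ disjointed (fun n => V (f n)) n with hD
    have hDm : ∀ n, MeasurableSet (D n) := fun n =>
      hs.inter (MeasurableSet.disjointed (fun i => (hVo (f i)).measurableSet) n)
    have hDd : Pairwise (Function.onFun Disjoint D) := fun i j hij =>
      (disjoint_disjointed _ hij).mono inter_subset_right inter_subset_right
    have hDU : s = ⋃ n, D n := by
      rw [hD, ← inter_iUnion, iUnion_disjointed, eq_comm, inter_eq_left]
      simpa using hT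
    calc (μHE[2] : Measure E3) (ν '' s) = (μHE[2] : Measure E3) (⋃ n, ν '' D n) := by
          rw [← image_iUnion, ← hDU]
      _ ≤ ∑' n, (μHE[2] : Measure E3) (ν '' D n) := measure_iUnion_le _
      _ ≤ ∑' n, ∫⁻ q in D n, (ENNReal.ofReal (gaussCurvature x ν q) + ε) ∂(areaMeasure x) := by
          refine ENNReal.tsum_le_tsum fun n => hV (f n) (hTs (mem_range_self n)) _ ?_ (hDm n)
          exact fun q hq => ⟨disjointed_subset (fun n => V (f n)) n hq.2, hq.1⟩
      _ = ∫⁻ q in s, (ENNReal.ofReal (gaussCurvature x ν q) + ε) ∂(areaMeasure x) := by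
          rw [← lintegral_iUnion hDm hDd, ← hDU]
      _ = (∫⁻ q in s, ENNReal.ofReal (gaussCurvature x ν q) ∂(areaMeasure x)) +
            ε * areaMeasure x s := by
          rw [lintegral_add_right _ measurable_const, setLIntegral_const]
      _ ≤ _ := by gcongr; exact subset_univ s
  set m := (areaMeasure x univ).toNNReal with hm
  have hmu : areaMeasure x univ = m := (ENNReal.coe_toNNReal (measure_ne_top _ _)).symm
  refine ENNReal.le_of_forall_pos_le_add fun ε hε _ => ?_
  refine (key (ε / (m + 1)) (by positivity)).trans ?_
  gcongr
  rw [hmu, ← ENNReal.coe_mul, ENNReal.coe_le_coe]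
  rw [div_mul_eq_mul_div, div_le_iff₀ (by positivity)]
  gcongr
  exact le_self_add

/-- Each clopen part of the surface has total curvature at least the area of the model cap. -/
lemma IsConvexCapillarySurface.measure_modelCap_le (hx : IsConvexCapillarySurface θ x ν)
    (hθ_pos : 0 < θ) (hθ_le : θ ≤ Real.pi / 2) {C : Set M} (hC : IsClopen C) (hne : C.Nonempty) :
    (μHE[2] : Measure E3) (modelCap θ) ≤
      ∫⁻ p in C ∩ (𝓡∂ 2).interior M, ENNReal.ofReal (gaussCurvature x ν p) ∂(areaMeasure x) := by
  have hU : MeasurableSet ((𝓡∂ 2).interior M) :=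
    ((𝓡∂ 2).isOpen_interior (n := 1) one_ne_zero).measurableSet
  set S := C ∩ (𝓡∂ 2).interior M with hS
  have hSm : MeasurableSet S := hC.isOpen.measurableSet.inter hU
  set Z := S ∩ {p | gaussCurvature x ν p = 0} with hZ
  have hZm : MeasurableSet Z := hSm.inter
    (hx.continuous_gaussCurvature.measurable (measurableSet_singleton 0))
  -- Directions reached only with the wrong sign are antipodes of normals at points where K = 0,
  -- hence negligible.
  have hZ0 : (μHE[2] : Measure E3) ((fun y => -y) '' (ν '' Z)) = 0 := by
    have hneg : Isometry fun y : E3 => -y := (LinearIsometryEquiv.neg ℝ (E := E3)).isometry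
    rw [hneg.euclideanHausdorffMeasure_image]
    refine le_antisymm ((hx.measure_normal_image_le hZm
      (inter_subset_left.trans inter_subset_right)).trans ?_) zero_le
    rw [setLIntegral_congr_fun (g := fun _ => 0) hZm fun p hp => by
      rw [show gaussCurvature x ν p = 0 from hp.2, ENNReal.ofReal_zero]]
    simp
  have hsub : modelCap θ ⊆ ν '' S ∪ (fun y => -y) '' (ν '' Z) := by
    rintro n ⟨hn, hnθ⟩
    rw [inner_e3] at hnθ
    obtain ⟨p, hpC, hpi, h | ⟨h, h0⟩⟩ := hx.exists_normal_eq hθ_pos hθ_le hC hne hn hnθ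
    · exact Or.inl ⟨p, ⟨hpC, hpi⟩, h⟩
    · exact Or.inr ⟨-n, ⟨p, ⟨⟨hpC, hpi⟩, h0⟩, h⟩, neg_neg n⟩
  calc (μHE[2] : Measure E3) (modelCap θ) ≤ _ := measure_mono hsub
    _ ≤ _ := measure_union_le _ _
    _ = (μHE[2] : Measure E3) (ν '' S) := by rw [hZ0, add_zero]
    _ ≤ _ := hx.measure_normal_image_le hSm inter_subset_right

end Area

/-! ### The model cap -/

lemma cos_nonneg_of_mem {θ : ℝ} (hθ_pos : 0 < θ) (hθ_le : θ ≤ Real.pi / 2) : 0 ≤ Real.cos θ :=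
  Real.cos_nonneg_of_neg_pi_div_two_le_of_le (by linarith) hθ_le

lemma cos_lt_one_of_mem {θ : ℝ} (hθ_pos : 0 < θ) (hθ_le : θ ≤ Real.pi / 2) : Real.cos θ < 1 := by
  rw [← Real.cos_zero]
  exact Real.cos_lt_cos_of_nonneg_of_le_pi_div_two le_rfl hθ_le hθ_pos

lemma norm_eq_iff {u : E3} {r : ℝ} (hr : 0 ≤ r) :
    ‖u‖ = r ↔ u 0 ^ 2 + u 1 ^ 2 + u 2 ^ 2 = r ^ 2 := by
  rw [← sq_eq_sq₀ (norm_nonneg u) hr, ← real_inner_self_eq_norm_sq, inner_eq_sum]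
  simp only [sq]

/-- The vertical projection of the cap contains a disc of radius sin θ. Positivity is what later
rules out a second component. -/
lemma measure_modelCap_pos {θ : ℝ} (hθ_pos : 0 < θ) (hθ_le : θ ≤ Real.pi / 2) :
    0 < (μHE[2] : Measure E3) (modelCap θ) := by
  have hc0 := cos_nonneg_of_mem hθ_pos hθ_le
  have hc1 := cos_lt_one_of_mem hθ_pos hθ_le
  have hsq : 0 < 1 - Real.cos θ ^ 2 := by nlinarith
  let Q : E3 → E2 := fun y => !₂[y 0, y 1]
  have hQ : LipschitzWith 1 Q := by
    refine LipschitzWith.of_dist_le_mul fun u w => ?_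
    rw [NNReal.coe_one, one_mul, EuclideanSpace.dist_eq, EuclideanSpace.dist_eq]
    apply Real.sqrt_le_sqrt
    simp [Q, Fin.sum_univ_two, Fin.sum_univ_three]
  have hsub : Metric.ball (0 : E2) (Real.sqrt (1 - Real.cos θ ^ 2)) ⊆ Q '' modelCap θ := by
    intro u hu
    have hu2 : u 0 ^ 2 + u 1 ^ 2 < 1 - Real.cos θ ^ 2 := by
      rw [mem_ball_zero_iff, EuclideanSpace.norm_eq, Real.sqrt_lt_sqrt_iff (by positivity)] at hu
      simpa [Fin.sum_univ_two] using hu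
    refine ⟨!₂[u 0, u 1, Real.sqrt (1 - (u 0 ^ 2 + u 1 ^ 2))], ⟨?_, ?_⟩, ?_⟩
    · rw [norm_eq_iff zero_le_one]
      simp
      rw [Real.sq_sqrt (by nlinarith [sq_nonneg (Real.cos θ)])]
      ring
    · rw [inner_e3]
      simp
      apply Real.lt_sqrt_of_sq_lt
      linarith
    · ext i; fin_cases i <;> simp [Q]
  have h1 := euclideanHausdorffMeasure_image_le_of_lipschitzOn (hQ.lipschitzOnWith (s := modelCap θ))
  rw [EuclideanSpace.euclideanHausdorffMeasure_eq_volume] at h1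
  have h2 : 0 < volume (Metric.ball (0 : E2) (Real.sqrt (1 - Real.cos θ ^ 2))) :=
    Metric.measure_ball_pos _ _ (Real.sqrt_pos.2 hsq)
  simpa using (h2.trans_le (measure_mono hsub)).trans_le h1

lemma measure_circle_eq_zero (c : E3) (r : ℝ) :
    (μHE[2] : Measure E3) {y | y 2 = 0 ∧ ‖y - c‖ = r} = 0 := by
  let J : E2 → E3 := fun u => !₂[u 0, u 1, 0]
  have hJ : Isometry J := by
    refine Isometry.of_dist_eq fun u w => ?_
    rw [EuclideanSpace.dist_eq, EuclideanSpace.dist_eq]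
    simp [J, Fin.sum_univ_two, Fin.sum_univ_three]
  let c' : E2 := !₂[c 0, c 1]
  have hsub : {y : E3 | y 2 = 0 ∧ ‖y - c‖ = r} ⊆
      J '' Metric.sphere c' (Real.sqrt (r ^ 2 - c 2 ^ 2)) := by
    rintro y ⟨h0, hy⟩
    refine ⟨!₂[y 0, y 1], ?_, ?_⟩
    · have hr : 0 ≤ r := hy ▸ norm_nonneg _
      rw [norm_eq_iff hr] at hy
      simp only [PiLp.sub_apply, h0] at hy
      rw [mem_sphere_iff_norm, EuclideanSpace.norm_eq]
      congr 1
      simp [Fin.sum_univ_two, c']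
      linarith
    · ext i; fin_cases i <;> simp [J, h0]
  refine measure_mono_null hsub ?_
  rw [hJ.euclideanHausdorffMeasure_image, EuclideanSpace.euclideanHausdorffMeasure_eq_volume]
  exact Measure.addHaar_sphere volume _ _

open scoped Pointwise in
lemma measure_affine_image (c : E3) {r : ℝ} (hr : 0 < r) (s : Set E3) :
    (μHE[2] : Measure E3).real ((fun n => c + r • n) '' s) = r ^ 2 * (μHE[2] : Measure E3).real s := by
  have h1 : (fun n => c + r • n) '' s = (fun y => c + y) '' (r • s) := by
    rw [← image_smul, image_image]
  have h2 : Isometry fun y : E3 => c + y := isometry_add_left c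
  rw [h1, Measure.real, h2.euclideanHausdorffMeasure_image,
    Measure.euclideanHausdorffMeasure_smul₀ 2 hr.ne', Measure.real, ENNReal.smul_def, smul_eq_mul,
    ENNReal.toReal_mul]
  simp [abs_of_pos hr]

section Willmore

variable {M : Type*} [TopologicalSpace M] [ChartedSpace (EuclideanHalfSpace 2) M]
  [IsManifold (𝓡∂ 2) ∞ M] {θ : ℝ} {x ν : M → E3}

lemma measurableSet_interior [MeasurableSpace M] [BorelSpace M] :
    MeasurableSet ((𝓡∂ 2).interior M) :=
  ((𝓡∂ 2).isOpen_interior (n := 1) one_ne_zero).measurableSet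

/-! ### The inequality -/

section Inequality

variable [CompactSpace M] [MeasurableSpace M] [BorelSpace M]

lemma IsCapillarySurface.integrable_of_continuous (hx : IsCapillarySurface θ x ν) {f : M → ℝ}
    (hf : Continuous f) : Integrable f (areaMeasure x) := by
  have := hx.isFiniteMeasure_areaMeasure
  obtain ⟨C, hC⟩ := isCompact_univ.exists_bound_of_continuousOn hf.continuousOn
  have : SecondCountableTopology M := hx.embedding.secondCountableTopology
  exact Integrable.of_bound hf.aestronglyMeasurable C (ae_of_all _ fun p => hC p (mem_univ p))

lemma IsConvexCapillarySurface.modelCap_real_le (hx : IsConvexCapillarySurface θ x ν)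
    (hθ_pos : 0 < θ) (hθ_le : θ ≤ Real.pi / 2) {C : Set M} (hC : IsClopen C) (hne : C.Nonempty) :
    (μHE[2] : Measure E3).real (modelCap θ) ≤
      ∫ p in C ∩ (𝓡∂ 2).interior M, gaussCurvature x ν p ∂(areaMeasure x) := by
  have hm : MeasurableSet (C ∩ (𝓡∂ 2).interior M) :=
    hC.isOpen.measurableSet.inter measurableSet_interior
  have h := hx.measure_modelCap_le hθ_pos hθ_le hC hne
  have hnn : ∀ᵐ p ∂(areaMeasure x).restrict (C ∩ (𝓡∂ 2).interior M), 0 ≤ gaussCurvature x ν p :=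
    (ae_restrict_iff' hm).2 (ae_of_all _ fun p hp => hx.gaussCurvature_nonneg hp.2)
  rw [← ofReal_integral_eq_lintegral_ofReal
    (hx.integrable_of_continuous hx.continuous_gaussCurvature).integrableOn hnn] at h
  exact ENNReal.toReal_le_of_le_ofReal (integral_nonneg_of_ae hnn) h

lemma IsConvexCapillarySurface.integrable_sq (hx : IsConvexCapillarySurface θ x ν) :
    Integrable (fun p => meanCurvature x ν p ^ 2) (areaMeasure x) :=
  hx.integrable_of_continuous (hx.continuous_meanCurvature.pow 2)

lemma IsConvexCapillarySurface.setIntegral_sq_le (hx : IsConvexCapillarySurface θ x ν) :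
    ∫ p in (𝓡∂ 2).interior M, meanCurvature x ν p ^ 2 ∂(areaMeasure x) ≤
      ∫ p, meanCurvature x ν p ^ 2 ∂(areaMeasure x) :=
  setIntegral_le_integral hx.integrable_sq (ae_of_all _ fun _ => sq_nonneg _)

lemma IsConvexCapillarySurface.four_setIntegral_gaussCurvature_le
    (hx : IsConvexCapillarySurface θ x ν) :
    4 * ∫ p in (𝓡∂ 2).interior M, gaussCurvature x ν p ∂(areaMeasure x) ≤
      ∫ p in (𝓡∂ 2).interior M, meanCurvature x ν p ^ 2 ∂(areaMeasure x) := by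
  rw [← integral_const_mul]
  refine setIntegral_mono_on ?_ hx.integrable_sq.integrableOn measurableSet_interior
    fun p hp => hx.four_gaussCurvature_le hp
  exact ((hx.integrable_of_continuous hx.continuous_gaussCurvature).const_mul 4).integrableOn

lemma IsConvexCapillarySurface.willmore_le (hx : IsConvexCapillarySurface θ x ν)
    (hθ_pos : 0 < θ) (hθ_le : θ ≤ Real.pi / 2) :
    4 * (μHE[2] : Measure E3).real (modelCap θ) ≤
      ∫ p, meanCurvature x ν p ^ 2 ∂(areaMeasure x) := by
  have h1 := hx.modelCap_real_le hθ_pos hθ_le isClopen_univ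
    (let ⟨p, _⟩ := hx.boundary_nonempty; ⟨p, mem_univ p⟩)
  rw [univ_inter] at h1
  linarith [hx.setIntegral_sq_le, hx.four_setIntegral_gaussCurvature_le]

end Inequality

/-! ### Rigidity -/

/-- Equality makes the continuous nonnegative function H² - 4K integrate to zero over the interior,
where every neighbourhood of a point has positive area. -/
lemma IsConvexCapillarySurface.umbilic_of_eq [CompactSpace M] [MeasurableSpace M] [BorelSpace M]
    (hx : IsConvexCapillarySurface θ x ν) (hθ_pos : 0 < θ) (hθ_le : θ ≤ Real.pi / 2)
    (heq : ∫ p, meanCurvature x ν p ^ 2 ∂(areaMeasure x) =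
      4 * (μHE[2] : Measure E3).real (modelCap θ)) {p : M} (hp : p ∈ (𝓡∂ 2).interior M) :
    4 * gaussCurvature x ν p = meanCurvature x ν p ^ 2 := by
  have h1 := hx.modelCap_real_le hθ_pos hθ_le isClopen_univ
    (let ⟨p, _⟩ := hx.boundary_nonempty; ⟨p, mem_univ p⟩)
  rw [univ_inter] at h1
  have hK := hx.integrable_of_continuous hx.continuous_gaussCurvature
  have hcont : Continuous fun p => meanCurvature x ν p ^ 2 - 4 * gaussCurvature x ν p :=
    (hx.continuous_meanCurvature.pow 2).sub (continuous_const.mul hx.continuous_gaussCurvature)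
  have h2 : ∫ p in (𝓡∂ 2).interior M, (meanCurvature x ν p ^ 2 - 4 * gaussCurvature x ν p)
      ∂(areaMeasure x) = 0 := by
    rw [integral_sub hx.integrable_sq.integrableOn (hK.const_mul 4).integrableOn,
      integral_const_mul]
    linarith [hx.setIntegral_sq_le, hx.four_setIntegral_gaussCurvature_le]
  have hnn : ∀ᵐ p ∂(areaMeasure x).restrict ((𝓡∂ 2).interior M),
      0 ≤ meanCurvature x ν p ^ 2 - 4 * gaussCurvature x ν p :=
    (ae_restrict_iff' measurableSet_interior).2
      (ae_of_all _ fun p hp => sub_nonneg.2 (hx.four_gaussCurvature_le hp))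
  rw [setIntegral_eq_zero_iff_of_nonneg_ae hnn
    (hx.integrable_of_continuous hcont).integrableOn] at h2
  by_contra hne
  have hpos : 0 < meanCurvature x ν p ^ 2 - 4 * gaussCurvature x ν p :=
    sub_pos.2 (lt_of_le_of_ne (hx.four_gaussCurvature_le hp) hne)
  have hV : {q | 0 < meanCurvature x ν q ^ 2 - 4 * gaussCurvature x ν q} ∩ (𝓡∂ 2).interior M ∈ 𝓝 p :=
    inter_mem (hcont.continuousAt.eventually_const_lt hpos)
      (((𝓡∂ 2).isOpen_interior (n := 1) one_ne_zero).mem_nhds hp)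
  have h3 := hx.measure_image_pos hp hV
  rw [← hx.areaMeasure_apply] at h3
  have h4 := (ae_restrict_iff' measurableSet_interior).1 h2
  refine h3.ne' (measure_mono_null ?_ (ae_iff.1 h4))
  rintro q ⟨hq1, hq2⟩ hq3
  exact (ne_of_gt hq1) (hq3 hq2)

lemma IsConvexCapillarySurface.differential_normal_chart_eq (hx : IsConvexCapillarySurface θ x ν)
    (humb : ∀ p ∈ (𝓡∂ 2).interior M, 4 * gaussCurvature x ν p = meanCurvature x ν p ^ 2) {p : M}
    {y : E2} (hy : y ∈ interior (extChartAt (𝓡∂ 2) p).target) :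
    fderiv ℝ (chartRep ν p) y =
      (meanCurvature x ν ((extChartAt (𝓡∂ 2) p).symm y) / 2) • fderiv ℝ (chartRep x p) y := by
  rw [hx.meanCurvature_symm hy]
  refine (hx.isConvexPatch p).fderiv_normal_eq_smul hy ?_
  rw [← hx.meanCurvature_symm hy, ← hx.gaussCurvature_symm hy]
  refine humb _ ((mem_interior_iff ((extChartAt (𝓡∂ 2) p).map_target (interior_subset hy))).2 ?_)
  rwa [(extChartAt (𝓡∂ 2) p).right_inv (interior_subset hy)]

/-- Boundary points need care, since the umbilic argument runs on open patches: in a chart, a ball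
cut by the half-plane is convex with nonempty interior, so constancy on its interior extends to all
of it by continuity. -/
lemma IsConvexCapillarySurface.isLocallyConstant_of_umbilic (hx : IsConvexCapillarySurface θ x ν)
    (humb : ∀ p ∈ (𝓡∂ 2).interior M, 4 * gaussCurvature x ν p = meanCurvature x ν p ^ 2) :
    IsLocallyConstant fun p => (meanCurvature x ν p / 2, ν p - (meanCurvature x ν p / 2) • x p) := by
  rw [IsLocallyConstant.iff_eventually_eq]
  intro p
  set F : M → ℝ × E3 :=
    fun p => (meanCurvature x ν p / 2, ν p - (meanCurvature x ν p / 2) • x p) with hF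
  have hFc : Continuous F := by
    have h1 := hx.continuous_meanCurvature
    have h2 := hx.smooth.continuous
    have h3 := hx.smooth_normal.continuous
    fun_prop
  set q₀ := extChartAt (𝓡∂ 2) p p with hq₀
  obtain ⟨ε, hε, hball⟩ := Metric.mem_nhdsWithin_iff.1 (extChartAt_target_mem_nhdsWithin (I := 𝓡∂ 2) p)
  set s := Metric.ball q₀ ε ∩ range (𝓡∂ 2) with hs
  have hsc : Convex ℝ s := (convex_ball _ _).inter (𝓡∂ 2).convex_range
  have hr : range (𝓡∂ 2) = {y : E2 | 0 ≤ y 0} := range_modelWithCornersEuclideanHalfSpace 2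
  have hsi : (interior s).Nonempty := by
    refine ⟨q₀ + (ε / 2) • EuclideanSpace.single 0 1, ?_⟩
    rw [hs, interior_inter, Metric.isOpen_ball.interior_eq,
      interior_range_modelWithCornersEuclideanHalfSpace]
    have hq0 : 0 ≤ q₀ 0 := by
      have : q₀ ∈ range (𝓡∂ 2) := extChartAt_target_subset_range p (mem_extChartAt_target p)
      rwa [hr] at this
    refine ⟨?_, ?_⟩
    · rw [mem_ball_iff_norm, add_sub_cancel_left, norm_smul]
      simp [abs_of_pos hε]
      linarith
    · simp
      linarith
  have hsub : interior s ⊆ interior (extChartAt (𝓡∂ 2) p).target := interior_mono hball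
  have hP := (hx.isConvexPatch p).mono isOpen_interior hsub
  have hcs : ContinuousOn (F ∘ (extChartAt (𝓡∂ 2) p).symm) s :=
    hFc.comp_continuousOn ((continuousOn_extChartAt_symm p).mono hball)
  obtain ⟨y₀, hy₀⟩ := hsi
  have hconst : EqOn (F ∘ (extChartAt (𝓡∂ 2) p).symm)
      (fun _ => F ((extChartAt (𝓡∂ 2) p).symm y₀)) (interior s) := by
    intro y hy
    have := hP.const_of_umbilic hsc.interior.isPreconnected
      (c := fun y => meanCurvature x ν ((extChartAt (𝓡∂ 2) p).symm y) / 2)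
      (fun y hy => hx.differential_normal_chart_eq humb (hsub hy)) hy hy₀
    exact Prod.ext this.1 this.2
  have hconst' := hconst.of_subset_closure hcs continuousOn_const interior_subset (by
    rw [hsc.closure_interior_eq_closure_of_nonempty_interior ⟨y₀, hy₀⟩]
    exact subset_closure)
  have hq₀s : q₀ ∈ s := ⟨Metric.mem_ball_self hε,
    extChartAt_target_subset_range p (mem_extChartAt_target p)⟩
  have hball' : extChartAt (𝓡∂ 2) p ⁻¹' Metric.ball q₀ ε ∈ 𝓝 p :=
    continuousAt_extChartAt p (Metric.ball_mem_nhds _ hε)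
  filter_upwards [hball', extChartAt_source_mem_nhds (I := 𝓡∂ 2) p] with q hq hqs
  have hqs' : extChartAt (𝓡∂ 2) p q ∈ s :=
    ⟨hq, extChartAt_target_subset_range p ((extChartAt (𝓡∂ 2) p).map_source hqs)⟩
  have h1 := hconst' hqs'
  have h2 := hconst' hq₀s
  simp only [Function.comp_apply, (extChartAt (𝓡∂ 2) p).left_inv hqs] at h1
  simp only [Function.comp_apply, hq₀, extChartAt_to_inv] at h2
  exact h1.trans h2.symm

/-- A full set of unit normals exhausts the spherical cap. -/
lemma mem_of_forall_cap {S : Set E3} (hS : IsClosed S) {c : E3} {r : ℝ} (hθ_pos : 0 < θ)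
    (hθ_le : θ ≤ Real.pi / 2) (h : ∀ n : E3, ‖n‖ = 1 → Real.cos θ < n 2 → c + r • n ∈ S)
    {n : E3} (hn : ‖n‖ = 1) (hnθ : Real.cos θ ≤ n 2) : c + r • n ∈ S := by
  rcases hnθ.lt_or_eq with hlt | he
  · exact h n hn hlt
  have hc0 := cos_nonneg_of_mem hθ_pos hθ_le
  have hc1 := cos_lt_one_of_mem hθ_pos hθ_le
  -- A normal on the rim is approached from inside the open cap by tilting it towards e₃ and
  -- normalizing.
  have hcont : ContinuousAt (fun ε : ℝ => c + r • (‖n + ε • e3‖⁻¹ • (n + ε • e3))) 0 := by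
    have h1 : ContinuousAt (fun ε : ℝ => n + ε • e3) 0 := by fun_prop
    exact continuousAt_const.add
      (((h1.norm.inv₀ (by simp [hn])).smul h1).const_smul r)
  have hlim : Tendsto (fun ε : ℝ => c + r • (‖n + ε • e3‖⁻¹ • (n + ε • e3))) (𝓝[>] 0)
      (𝓝 (c + r • n)) := by
    have := hcont.tendsto.mono_left (nhdsWithin_le_nhds (s := Ioi 0))
    simpa [hn] using this
  refine hS.mem_of_tendsto hlim ?_
  filter_upwards [self_mem_nhdsWithin] with ε hε
  have hε' : 0 < ε := hε
  set m := ‖n + ε • e3‖ with hm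
  have hm2 : m ^ 2 = 1 + 2 * Real.cos θ * ε + ε ^ 2 := by
    rw [hm, norm_add_sq_real, inner_smul_right, inner_e3, ← he, hn, norm_smul, norm_e3]
    simp
    ring
  have hm0 : 0 < m := by
    have : 0 < m ^ 2 := by rw [hm2]; positivity
    exact lt_of_le_of_ne (norm_nonneg _) fun h0 : 0 = m => by simp [← h0] at this
  apply h
  · rw [norm_smul, norm_inv, norm_norm]
    exact inv_mul_cancel₀ hm0.ne'
  · have : (m⁻¹ • (n + ε • e3)) 2 = (Real.cos θ + ε) / m := by
      simp [e3, ← he]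
      field_simp
    rw [this, lt_div_iff₀ hm0]
    refine lt_of_pow_lt_pow_left₀ 2 (by positivity) ?_
    rw [mul_pow, hm2]
    have : 0 < 1 - Real.cos θ ^ 2 := by nlinarith
    -- With C = cos θ, the difference of the two sides is (1 - C²)(ε² + 2Cε).
    nlinarith [mul_pos (pow_pos hε' 2) this, mul_nonneg (mul_nonneg hc0 hε'.le) this.le]

lemma mem_translated_cap_iff {r : ℝ} {a c y : E3} (ha : a 2 = 0)
    (hc : c = a - (r * Real.cos θ) • e3) :
    y ∈ (fun z => a + z) '' sphericalCap r θ ↔ 0 ≤ y 2 ∧ ‖y - c‖ = r := by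
  have key : y - a - (r * Real.cos θ) • -e3 = y - c := by
    rw [hc, smul_neg]; abel
  constructor
  · rintro ⟨z, ⟨h0, h1⟩, rfl⟩
    have hz : a + z - a = z := add_sub_cancel_left a z
    rw [hz] at key
    rw [← key]
    refine ⟨?_, h1⟩
    simpa [ha] using h0
  · rintro ⟨h0, h1⟩
    refine ⟨y - a, ⟨?_, by rw [key]; exact h1⟩, add_sub_cancel a y⟩
    simpa [ha] using h0

lemma IsConvexCapillarySurface.range_eq_of_eq [CompactSpace M] [MeasurableSpace M] [BorelSpace M]
    (hx : IsConvexCapillarySurface θ x ν) (hθ_pos : 0 < θ) (hθ_le : θ ≤ Real.pi / 2)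
    (heq : ∫ p, meanCurvature x ν p ^ 2 ∂(areaMeasure x) =
      4 * (μHE[2] : Measure E3).real (modelCap θ)) :
    ∃ r : ℝ, 0 < r ∧ ∃ a : E3, a 2 = 0 ∧ range x = (fun y => a + y) '' sphericalCap r θ := by
  have hc0 := cos_nonneg_of_mem hθ_pos hθ_le
  have hc1 := cos_lt_one_of_mem hθ_pos hθ_le
  have humb := fun p hp => hx.umbilic_of_eq hθ_pos hθ_le heq (p := p) hp
  have hloc := hx.isLocallyConstant_of_umbilic humb
  obtain ⟨p₀, hp₀⟩ := hx.boundary_nonempty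
  set k : ℝ := meanCurvature x ν p₀ / 2 with hk
  set f : E3 := ν p₀ - k • x p₀ with hf
  set C : Set M := {p | (meanCurvature x ν p / 2, ν p - (meanCurvature x ν p / 2) • x p) = (k, f)}
    with hCdef
  have hC : IsClopen C := hloc.isClopen_fiber (k, f)
  have hp₀C : p₀ ∈ C := rfl
  have hCν : ∀ p ∈ C, meanCurvature x ν p / 2 = k ∧ ν p = k • x p + f := by
    intro p hp
    have h1 : meanCurvature x ν p / 2 = k := congrArg Prod.fst hp
    have h2 : ν p - (meanCurvature x ν p / 2) • x p = f := congrArg Prod.snd hp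
    refine ⟨h1, ?_⟩
    rw [← h2, h1]; abel
  -- the surface has a single component
  have hSpos : 0 < (μHE[2] : Measure E3).real (modelCap θ) := by
    have hlt : (μHE[2] : Measure E3) (modelCap θ) < ⊤ := by
      refine (hx.measure_modelCap_le hθ_pos hθ_le isClopen_univ ⟨p₀, mem_univ _⟩).trans_lt ?_
      exact ((hx.integrable_of_continuous hx.continuous_gaussCurvature).integrableOn).lintegral_lt_top
    exact ENNReal.toReal_pos (measure_modelCap_pos hθ_pos hθ_le).ne' hlt.ne
  have hCuniv : ∀ p, p ∈ C := by
    by_contra! hne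
    obtain ⟨q, hq⟩ := hne
    have hK := hx.integrable_of_continuous hx.continuous_gaussCurvature
    -- `C` and its complement would each carry total curvature at least |S|, whereas equality allows
    -- only |S| in all.
    have h1 := hx.modelCap_real_le hθ_pos hθ_le hC ⟨p₀, hp₀C⟩
    have h2 := hx.modelCap_real_le hθ_pos hθ_le hC.compl ⟨q, hq⟩
    have h3 := setIntegral_union (f := gaussCurvature x ν) (μ := areaMeasure x)
      (s := C ∩ (𝓡∂ 2).interior M) (t := Cᶜ ∩ (𝓡∂ 2).interior M)
      (disjoint_compl_right.mono inter_subset_left inter_subset_left)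
      (hC.compl.isOpen.measurableSet.inter measurableSet_interior) hK.integrableOn hK.integrableOn
    rw [← union_inter_distrib_right, union_compl_self, univ_inter] at h3
    linarith [hx.setIntegral_sq_le, hx.four_setIntegral_gaussCurvature_le]
  -- the principal curvature is positive
  obtain ⟨p, -, hpi, hp⟩ := hx.exists_normal_eq hθ_pos hθ_le isClopen_univ ⟨p₀, mem_univ _⟩ norm_e3
    (by simpa [e3] using hc1)
  have hν₀ := hx.normal_boundary hp₀
  have hk0 : 0 ≤ k := by
    have hq := extChartAt_mem_interior hpi
    have hP := hx.isConvexPatch p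
    have h1 := hx.differential_normal_chart_eq humb hq
    rw [extChartAt_to_inv, (hCν p (hCuniv p)).1] at h1
    have h2 := hP.convex _ hq (EuclideanSpace.single 0 1)
    rw [h1, _root_.smul_apply, inner_smul_left] at h2
    have h3 : (0 : ℝ) < inner ℝ (fderiv ℝ (chartRep x p) (extChartAt (𝓡∂ 2) p p)
        (EuclideanSpace.single 0 1)) (fderiv ℝ (chartRep x p) (extChartAt (𝓡∂ 2) p p)
        (EuclideanSpace.single 0 1)) := pairingMatrix_self_pos (hP.injective _ hq)
    exact nonneg_of_mul_nonneg_left h2 h3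
  -- If k = 0 then ν is constant, but its third component is cos θ in [0, 1) on the boundary and ±1
  -- where ν = ±e₃.
  have hkne : k ≠ 0 := by
    intro h0
    have h1 := (hCν p (hCuniv p)).2
    have h2 := (hCν p₀ (hCuniv p₀)).2
    rw [h0, zero_smul, zero_add] at h1 h2
    have h3 : ν p 2 = Real.cos θ := by rw [h1, ← h2, hν₀]
    rcases hp with h4 | ⟨h4, -⟩
    · rw [h4] at h3; simp [e3] at h3; linarith
    · rw [h4] at h3; simp [e3] at h3; linarith
  have hkpos : 0 < k := lt_of_le_of_ne hk0 hkne.symm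
  set r : ℝ := k⁻¹ with hr
  have hrpos : 0 < r := inv_pos.2 hkpos
  set c : E3 := -(r • f) with hc
  have hxc : ∀ q, x q = c + r • ν q := by
    intro q
    rw [(hCν q (hCuniv q)).2, smul_add, smul_smul, hr, inv_mul_cancel₀ hkne, one_smul, hc, ← hr]
    abel
  have hc2 : c 2 = - (r * Real.cos θ) := by
    have h1 := congrArg (fun y : E3 => y 2) (hxc p₀)
    simp [hx.boundary_zero p₀ hp₀, hν₀] at h1
    linarith
  refine ⟨r, hrpos, c + (r * Real.cos θ) • e3, by simp [e3, hc2], ?_⟩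
  ext y
  rw [mem_translated_cap_iff (by simp [e3, hc2]) (add_sub_cancel_right c _).symm]
  constructor
  · rintro ⟨q, rfl⟩
    refine ⟨hx.nonneg q, ?_⟩
    rw [hxc q, add_sub_cancel_left, norm_smul, hx.norm_normal, Real.norm_eq_abs, abs_of_pos hrpos,
      mul_one]
  · rintro ⟨h0, h1⟩
    have hclosed : IsClosed (range x) := (isCompact_range hx.smooth.continuous).isClosed
    have hy : y = c + r • (r⁻¹ • (y - c)) := by
      rw [smul_smul, mul_inv_cancel₀ hrpos.ne', one_smul]; abel
    rw [hy]
    refine mem_of_forall_cap hclosed hθ_pos hθ_le ?_ ?_ ?_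
    · intro n hn hnθ
      obtain ⟨q, -, -, hq⟩ := hx.exists_normal_eq hθ_pos hθ_le isClopen_univ ⟨p₀, mem_univ _⟩ hn hnθ
      refine ⟨q, ?_⟩
      rcases hq with hq | ⟨hq, -⟩
      · rw [hxc q, hq]
      · exfalso
        have h2 := congrArg (fun y : E3 => y 2) (hxc q)
        have h3 := hx.nonneg q
        simp [hq, hc2] at h2
        have h4 : 0 < r * n 2 := mul_pos hrpos (hc0.trans_lt hnθ)
        have h5 : 0 ≤ r * Real.cos θ := by positivity
        linarith
    · rw [norm_smul, h1, Real.norm_eq_abs, abs_of_pos (by positivity), inv_mul_cancel₀ hrpos.ne']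
    · simp [hc2]
      rw [mul_add, ← mul_assoc, inv_mul_cancel₀ hrpos.ne', one_mul]
      have : 0 ≤ r⁻¹ * y 2 := by positivity
      linarith

/-- The factors r² in the area of the cap and 1/r² in H² cancel. The boundary lies on a circle,
hence is null, and the interior is exactly the scaled and translated open model cap. -/
lemma IsConvexCapillarySurface.eq_of_range_eq [CompactSpace M] [MeasurableSpace M] [BorelSpace M]
    (hx : IsConvexCapillarySurface θ x ν) {r : ℝ} (hr : 0 < r) {a : E3} (ha : a 2 = 0)
    (hrange : range x = (fun y => a + y) '' sphericalCap r θ) :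
    ∫ p, meanCurvature x ν p ^ 2 ∂(areaMeasure x) =
      4 * (μHE[2] : Measure E3).real (modelCap θ) := by
  have := hx.isFiniteMeasure_areaMeasure
  obtain ⟨c, hc⟩ : ∃ c, c = a - (r * Real.cos θ) • e3 := ⟨_, rfl⟩
  have hc2 : c 2 = - (r * Real.cos θ) := by simp [hc, ha, e3]
  have hmem : ∀ y, y ∈ range x ↔ 0 ≤ y 2 ∧ ‖y - c‖ = r := fun y => by
    rw [hrange]; exact mem_translated_cap_iff ha hc
  have hxc : ∀ p, ‖x p - c‖ = r := fun p => ((hmem _).1 (mem_range_self p)).2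
  have hH : ∀ p ∈ (𝓡∂ 2).interior M, meanCurvature x ν p ^ 2 = 4 / r ^ 2 := by
    intro p hp
    have h := (hx.isConvexPatch p).trace_sq_of_sphere (extChartAt_mem_interior hp) hr
      (c := c) (fun z _ => hxc _)
    rwa [← hx.meanCurvature_symm (extChartAt_mem_interior hp), extChartAt_to_inv] at h
  have hbd : areaMeasure x ((𝓡∂ 2).interior M)ᶜ = 0 := by
    rw [hx.areaMeasure_apply]
    refine measure_mono_null ?_ (measure_circle_eq_zero c r)
    rintro _ ⟨p, hp, rfl⟩
    rw [ModelWithCorners.compl_interior] at hp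
    exact ⟨hx.boundary_zero p hp, hxc p⟩
  have himg : x '' (𝓡∂ 2).interior M = (fun n => c + r • n) '' modelCap θ := by
    ext y
    constructor
    · rintro ⟨p, hp, rfl⟩
      refine ⟨r⁻¹ • (x p - c), ⟨?_, ?_⟩, ?_⟩
      · rw [norm_smul, hxc, Real.norm_eq_abs, abs_of_pos (by positivity), inv_mul_cancel₀ hr.ne']
      · rw [inner_e3]
        simp [hc2]
        rw [mul_add, ← mul_assoc, inv_mul_cancel₀ hr.ne', one_mul]
        have := mul_pos (inv_pos.2 hr) (hx.interior_pos p hp)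
        linarith
      · simp only [smul_smul]
        rw [mul_inv_cancel₀ hr.ne', one_smul]; abel
    · rintro ⟨n, ⟨hn, hnθ⟩, rfl⟩
      rw [inner_e3] at hnθ
      have hpos : 0 < (c + r • n) 2 := by
        simp [hc2]
        nlinarith
      obtain ⟨p, hp⟩ := (hmem (c + r • n)).2 ⟨hpos.le, by
        rw [add_sub_cancel_left, norm_smul, hn, Real.norm_eq_abs, abs_of_pos hr, mul_one]⟩
      exact ⟨p, hx.mem_interior_iff_pos.2 (by rw [hp]; exact hpos), hp⟩
  have hreal : (areaMeasure x).real ((𝓡∂ 2).interior M) =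
      r ^ 2 * (μHE[2] : Measure E3).real (modelCap θ) := by
    rw [Measure.real, hx.areaMeasure_apply, himg]
    exact measure_affine_image c hr _
  rw [← integral_add_compl measurableSet_interior hx.integrable_sq,
    setIntegral_measure_zero _ hbd, add_zero, setIntegral_congr_fun measurableSet_interior hH,
    setIntegral_const, hreal, smul_eq_mul]
  field_simp

end Willmore

end CapillarySurface

end

/-- The Willmore inequality for convex capillary surfaces in the upper half-space. -/
theorem corollary1p3 {M : Type*} [TopologicalSpace M] [ChartedSpace (EuclideanHalfSpace 2) M]
    [IsManifold (𝓡∂ 2) ∞ M] [CompactSpace M] [MeasurableSpace M] [BorelSpace M]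
    (θ : ℝ) (hθ_pos : 0 < θ) (hθ_le : θ ≤ Real.pi / 2) (x ν : M → CapillarySurface.E3)
    (hx : CapillarySurface.IsConvexCapillarySurface θ x ν) :
    Integrable (fun p => CapillarySurface.meanCurvature x ν p ^ 2)
        (CapillarySurface.areaMeasure x) ∧
      4 * (μHE[2] : Measure CapillarySurface.E3).real (CapillarySurface.modelCap θ) ≤
        ∫ p, CapillarySurface.meanCurvature x ν p ^ 2 ∂(CapillarySurface.areaMeasure x) ∧
      (∫ p, CapillarySurface.meanCurvature x ν p ^ 2 ∂(CapillarySurface.areaMeasure x) =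
          4 * (μHE[2] : Measure CapillarySurface.E3).real (CapillarySurface.modelCap θ) ↔
        ∃ r : ℝ, 0 < r ∧ ∃ a : CapillarySurface.E3, a 2 = 0 ∧
          Set.range x = (fun y => a + y) '' CapillarySurface.sphericalCap r θ) :=
  ⟨hx.integrable_sq, hx.willmore_le hθ_pos hθ_le, hx.range_eq_of_eq hθ_pos hθ_le,
    fun ⟨_, hr, _, ha, h⟩ => hx.eq_of_range_eq hr ha h⟩
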